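/- Let $d,k,l\geq 1$ be integers and let $\mathcal{C}=\{\ell_1,\dots,\ell_d,C_1,\dots,C_k,\mathcal{E}_1,\dots,\mathcal{E}_l\}$ be an arrangement of $d$ lines, $k$ smooth conics and $l$ elliptic curves (smooth cubics), pairwise distinct, in the complex projective plane $\mathbb{P}^2_{\mathbb{C}}$. Assume that every singular point of the union of these curves is a singularity of one of the types $A_1, A_3, D_4, A_5, A_7, A_{11}, D_{14}$, where type $A_m$ (respectively $D_m$) means that the germ of the curve at the point is isomorphic to the germ at the origin of $x^2+y^{m+1}=0$ (respectively $x^2y+y^{m-1}=0$). Let $n_2,t_3,n_3,t_5,t_7,t_{11},d_{14}$ be the numbers of singular points of type $A_1, A_3, D_4, A_5, A_7, A_{11}, D_{14}$, respectively. Then $$(d+2k+3l)^2-d-4k-9l = d(d-1)+4k(k-1)+9l(l-1)+4dk+6dl+12kl = 2n_2+4t_3+6n_3+6t_5+8t_7+12t_{11}+16d_{14}.$$ -/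

import Mathlib

open scoped LinearAlgebra.Projectivization

namespace PlaneCurve

noncomputable section

/-- The complex projective plane. -/
abbrev P2 : Type := ℙ ℂ (Fin 3 → ℂ)

/-- The zero locus in the projective plane of a ternary form `F`
(for homogeneous `F` the choice of representative is irrelevant). -/
def zeroLocus (F : MvPolynomial (Fin 3) ℂ) : Set P2 :=
  {p | MvPolynomial.eval p.rep F = 0}

/-- The singular points of the plane curve `F = 0`: the points of the curve at which all
partial derivatives of `F` vanish. -/
def singularLocus (F : MvPolynomial (Fin 3) ℂ) : Set P2 :=
  {p | p ∈ zeroLocus F ∧ ∀ i, MvPolynomial.eval p.rep (MvPolynomial.pderiv i F) = 0}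

/-- `F` is an equation of a smooth plane curve of degree `n` (for `n ≥ 1` the condition on
singular points forces `F ≠ 0`). Degree `1`: lines; degree `2`: smooth conics; degree `3`:
plane elliptic curves. -/
structure IsSmoothEquation (F : MvPolynomial (Fin 3) ℂ) (n : ℕ) : Prop where
  homogeneous : F.IsHomogeneous n
  smooth : singularLocus F = ∅

/-- The local equation `F (v + x • a + y • b)`, as a power series in the affine coordinates
`x = X 0`, `y = X 1` centred at the point `[v]`; here `v, a, b` is a basis of `ℂ³`. -/
def localEquation (F : MvPolynomial (Fin 3) ℂ) (v a b : Fin 3 → ℂ) :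
    MvPowerSeries (Fin 2) ℂ :=
  ((MvPolynomial.aeval (fun i : Fin 3 =>
      (MvPolynomial.C (v i) + MvPolynomial.C (a i) * MvPolynomial.X 0
        + MvPolynomial.C (b i) * MvPolynomial.X 1 : MvPolynomial (Fin 2) ℂ)) F :
      MvPolynomial (Fin 2) ℂ) : MvPowerSeries (Fin 2) ℂ)

/-- The germ at `p` of the curve `F = 0` is isomorphic to the germ `g = 0` at the origin:
an automorphism of the complete local ring `ℂ⟦x, y⟧` takes a local equation of the curve at `p`
to a unit multiple of `g`. (For homogeneous `F` this does not depend on the affine coordinates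
`a, b`: changing them amounts to an automorphism of `ℂ⟦x, y⟧` and a unit factor.) -/
def HasGerm (F : MvPolynomial (Fin 3) ℂ) (p : P2) (g : MvPowerSeries (Fin 2) ℂ) : Prop :=
  ∃ a b : Fin 3 → ℂ, LinearIndependent ℂ ![p.rep, a, b] ∧
    ∃ φ : MvPowerSeries (Fin 2) ℂ ≃ₐ[ℂ] MvPowerSeries (Fin 2) ℂ,
      Associated (φ (localEquation F p.rep a b)) g

/-- The normal form `x ^ 2 + y ^ (m + 1)` of the singularity `A_m`, `m ≥ 1`. -/
def normalFormA (m : ℕ) : MvPowerSeries (Fin 2) ℂ :=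
  MvPowerSeries.X 0 ^ 2 + MvPowerSeries.X 1 ^ (m + 1)

/-- The normal form `x ^ 2 * y + y ^ (m - 1)` of the singularity `D_m`, `m ≥ 4`. -/
def normalFormD (m : ℕ) : MvPowerSeries (Fin 2) ℂ :=
  MvPowerSeries.X 0 ^ 2 * MvPowerSeries.X 1 + MvPowerSeries.X 1 ^ (m - 1)

/-- The points at which the curve `F = 0` has a singularity of type `A_m`. -/
def pointsA (F : MvPolynomial (Fin 3) ℂ) (m : ℕ) : Set P2 := {p | HasGerm F p (normalFormA m)}

/-- The points at which the curve `F = 0` has a singularity of type `D_m`. -/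
def pointsD (F : MvPolynomial (Fin 3) ℂ) (m : ℕ) : Set P2 := {p | HasGerm F p (normalFormD m)}

/-- An arrangement of `d` pairwise distinct lines, `k` pairwise distinct smooth conics and `l`
pairwise distinct elliptic curves (smooth cubics) in the complex projective plane, each curve
given by an equation. -/
structure Arrangement (d k l : ℕ) where
  line : Fin d → MvPolynomial (Fin 3) ℂ
  conic : Fin k → MvPolynomial (Fin 3) ℂ
  cubic : Fin l → MvPolynomial (Fin 3) ℂ
  line_smooth : ∀ i, IsSmoothEquation (line i) 1
  conic_smooth : ∀ i, IsSmoothEquation (conic i) 2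
  cubic_smooth : ∀ i, IsSmoothEquation (cubic i) 3
  line_distinct : Function.Injective fun i => zeroLocus (line i)
  conic_distinct : Function.Injective fun i => zeroLocus (conic i)
  cubic_distinct : Function.Injective fun i => zeroLocus (cubic i)

/-- The equation of the union of all curves of the arrangement. -/
def Arrangement.equation {d k l : ℕ} (𝒞 : Arrangement d k l) : MvPolynomial (Fin 3) ℂ :=
  (∏ i, 𝒞.line i) * (∏ i, 𝒞.conic i) * ∏ i, 𝒞.cubic i

end

end PlaneCurve

/-!
Each curve `Fᵢ`, of degree `nᵢ`, meets the union `Gᵢ` of the other curves in `nᵢ (N - nᵢ)` points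
counted with multiplicity, where `N = ∑ nᵢ`. Summed over `i` this gives
`N ^ 2 - ∑ nᵢ ^ 2 = (d + 2k + 3l) ^ 2 - d - 4k - 9l`. All intersections lie at singular points `p`
of the union, and there `∑ᵢ I_p(Fᵢ, Gᵢ)` depends only on the type of the singularity. Since the
curves are smooth, their local equations at `p` are units or irreducible, and their product is, up
to an automorphism and a unit, the normal form. The latter is a product of explicit primes of
`ℂ⟦x, y⟧`: `x = ± i y ^ r` for `A_{2r-1}`, and `y = 0` in addition for `D_{2r+2}`. By uniqueness of
prime factorizations the sum is `2r`, respectively `2r + 4`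
(`PS.card_and_totalInter_eq`, `HasGerm.ncard_and_totalInter`). The number of curves through `p` is
determined as well; it separates `D₄` from `A₅`, so that the types are mutually exclusive.

Bézout's theorem (`sum_inter_eq_mul`) is proved for `I_p(f, g) = dim ℂ⟦x, y⟧ / (f, g)`. The singular
locus is finite, because the numbers of points of each type are, so some line avoids it and may be
taken as the line at infinity. Then the top forms of the affine equations `f, g` of `Fᵢ, Gᵢ` have no
common zero, hence are coprime, and cancellation of leading forms computes the dimension of the
image of the polynomials of bounded degree in `ℂ[x, y] / (f, g)`, so that this quotient has dimension
`deg f * deg g` (`Aff.finrank_quotient_eq`). By the Nullstellensatz and the Chinese remainder theorem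
the quotient is the product of the local algebras `ℂ⟦x, y⟧ / (f, g)` at the common zeros
(`Aff.finrank_quotient_eq_sum`). That no curve is a component of the union of the others need not
be checked separately, since it follows from the finiteness of the singular locus.

The germ of a curve at a point is given in an arbitrary projective frame; a change of frame with the
same first point acts on the local equations by an automorphism of `ℂ⟦x, y⟧` and a unit factor
(`exists_algEquiv_localEquation`).
-/

/-! ### Power series in two variables and local intersection numbers -/

namespace PlaneCurve

/-- The complete local ring of the plane at a point, in affine coordinates centred there. -/
abbrev PS : Type := MvPowerSeries (Fin 2) ℂ

namespace PS

open MvPowerSeries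

instance : IsDomain PS := NoZeroDivisors.to_isDomain _

/-- The linear coefficients obey the product rule. -/
theorem coeff_single_mul (a b : PS) (i : Fin 2) : coeff (Finsupp.single i 1) (a * b) =
    constantCoeff a * coeff (Finsupp.single i 1) b +
      coeff (Finsupp.single i 1) a * constantCoeff b := by
  classical
  rw [coeff_mul, Finsupp.antidiagonal_single]
  simp only [Finset.sum_map]
  rw [Finset.Nat.sum_antidiagonal_eq_sum_range_succ_mk, Finset.sum_range_succ,
    Finset.sum_range_one]
  simp

theorem isUnit_iff {f : PS} : IsUnit f ↔ constantCoeff f ≠ 0 := by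
  rw [isUnit_iff_constantCoeff, isUnit_iff_ne_zero]

/-- A power series of order one is irreducible, since a product of two series without constant
term has no linear term. -/
theorem irreducible_of_coeff_ne_zero {f : PS} (h0 : constantCoeff f = 0) {i : Fin 2}
    (hi : coeff (Finsupp.single i 1) f ≠ 0) : Irreducible f := by
  refine ⟨fun h => isUnit_iff.1 h h0, fun a b hab => ?_⟩
  by_contra! h
  simp only [isUnit_iff, not_not] at h
  exact hi (by rw [hab, coeff_single_mul, h.1, h.2, zero_mul, mul_zero, add_zero])

/-- The substitution endomorphism sending the variables to series without constant term. -/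
noncomputable def substHom (s : Fin 2 → PS) (hs : ∀ i, constantCoeff (s i) = 0) : PS →ₐ[ℂ] PS :=
  substAlgHom (hasSubst_of_constantCoeff_zero hs)

theorem substHom_X (s : Fin 2 → PS) (hs : ∀ i, constantCoeff (s i) = 0) (i : Fin 2) :
    substHom s hs (X i) = s i :=
  substAlgHom_X _ i

theorem substHom_comp_eq_id (s t : Fin 2 → PS) (hs : ∀ i, constantCoeff (s i) = 0)
    (ht : ∀ i, constantCoeff (t i) = 0) (h : ∀ i, substHom s hs (t i) = X i) :
    (substHom s hs).comp (substHom t ht) = AlgHom.id ℂ PS := by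
  have hs' := hasSubst_of_constantCoeff_zero hs
  have ht' := hasSubst_of_constantCoeff_zero ht
  ext1 f
  have h1 : (fun i => subst s (t i)) = (X : Fin 2 → PS) := by
    funext i
    rw [← h i, substHom, substAlgHom_apply]
  simp only [substHom, AlgHom.comp_apply, substAlgHom_apply, AlgHom.id_apply]
  rw [subst_comp_subst_apply ht' hs', h1, subst_self, id]

/-- Two mutually inverse substitutions form an automorphism. -/
noncomputable def substEquiv (s t : Fin 2 → PS) (hs : ∀ i, constantCoeff (s i) = 0)
    (ht : ∀ i, constantCoeff (t i) = 0) (h₁ : ∀ i, substHom s hs (t i) = X i)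
    (h₂ : ∀ i, substHom t ht (s i) = X i) : PS ≃ₐ[ℂ] PS :=
  AlgEquiv.ofAlgHom (substHom s hs) (substHom t ht) (substHom_comp_eq_id s t hs ht h₁)
    (substHom_comp_eq_id t s ht hs h₂)

theorem mem_span_X_pow_iff {a b : ℕ} {f : PS} :
    f ∈ Ideal.span {(X 0 : PS) ^ a, X 1 ^ b} ↔
      ∀ s : Fin 2 →₀ ℕ, s 0 < a → s 1 < b → coeff s f = 0 := by
  classical
  rw [Ideal.mem_span_pair]
  constructor
  · rintro ⟨u, v, rfl⟩ s h0 h1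
    have hu : coeff s (u * X 0 ^ a) = 0 := X_pow_dvd_iff.1 (Dvd.intro_left u rfl) s h0
    have hv : coeff s (v * X 1 ^ b) = 0 := X_pow_dvd_iff.1 (Dvd.intro_left v rfl) s h1
    rw [map_add, hu, hv, add_zero]
  · intro h
    let g : PS := fun s => if s 0 < a then 0 else coeff s f
    have hg : ∀ s, coeff s g = if s 0 < a then 0 else coeff s f := fun s => rfl
    obtain ⟨u, hu⟩ : (X 0 : PS) ^ a ∣ g := X_pow_dvd_iff.2 fun s hs => by rw [hg, if_pos hs]
    obtain ⟨v, hv⟩ : (X 1 : PS) ^ b ∣ f - g := X_pow_dvd_iff.2 fun s hs => by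
      rw [map_sub, hg]
      split_ifs with h0
      · rw [h s h0 hs, sub_zero]
      · rw [sub_self]
    exact ⟨u, v, by rw [mul_comm u, mul_comm v, ← hu, ← hv]; ring⟩

/-- The local intersection number `dim ℂ⟦x, y⟧ / (f, g)` (`0` if the dimension is infinite). -/
noncomputable def inter (f g : PS) : ℕ := Module.finrank ℂ (PS ⧸ Ideal.span {f, g})

theorem inter_X_pow (a b : ℕ) : inter (X 0 ^ a) (X 1 ^ b) = a * b := by
  classical
  let e : Fin a × Fin b → (Fin 2 →₀ ℕ) := fun q =>
    Finsupp.single 0 (q.1 : ℕ) + Finsupp.single 1 (q.2 : ℕ)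
  have he0 : ∀ q, e q 0 = q.1 := fun q => by simp [e]
  have he1 : ∀ q, e q 1 = q.2 := fun q => by simp [e]
  have hinj : Function.Injective e := fun q r h => by
    ext
    · rw [← he0, h, he0]
    · rw [← he1, h, he1]
  let L : PS →ₗ[ℂ] (Fin a × Fin b → ℂ) := LinearMap.pi fun q => coeff (e q)
  have hL : Function.Surjective L := by
    intro w
    refine ⟨fun s => ∑ q, if e q = s then w q else 0, ?_⟩
    ext q
    change ∑ r, (if e r = e q then w r else 0) = w q
    simp [hinj.eq_iff]
  have hker : LinearMap.ker L = (Ideal.span {(X 0 : PS) ^ a, X 1 ^ b}).restrictScalars ℂ := by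
    ext f
    rw [LinearMap.mem_ker, Submodule.restrictScalars_mem, mem_span_X_pow_iff]
    constructor
    · intro h s h0 h1
      have := congr_fun h (⟨s 0, h0⟩, ⟨s 1, h1⟩)
      have hs : e (⟨s 0, h0⟩, ⟨s 1, h1⟩) = s := by
        ext i
        fin_cases i
        · exact he0 _
        · exact he1 _
      change coeff (e (⟨s 0, h0⟩, ⟨s 1, h1⟩)) f = 0 at this
      rwa [hs] at this
    · intro h
      ext q
      exact h _ (by rw [he0]; exact q.1.2) (by rw [he1]; exact q.2.2)
  have h1 := (L.quotKerEquivOfSurjective hL).finrank_eq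
  rw [hker] at h1
  rw [inter]
  refine h1.trans ?_
  simp

theorem inter_comm (f g : PS) : inter f g = inter g f := by
  rw [inter, inter, Set.pair_comm]

theorem inter_map (φ : PS ≃ₐ[ℂ] PS) (f g : PS) : inter (φ f) (φ g) = inter f g := by
  refine (Ideal.quotientEquivAlg _ _ φ ?_).toLinearEquiv.finrank_eq.symm
  rw [Ideal.map_span, Set.image_pair]
  rfl

theorem inter_congr {f f' g g' : PS} (h : Ideal.span {f, g} = Ideal.span {f', g'}) :
    inter f g = inter f' g' := by
  rw [inter, inter, h]

theorem inter_of_associated {f f' g g' : PS} (hf : Associated f f') (hg : Associated g g') :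
    inter f g = inter f' g' := by
  refine inter_congr ?_
  rw [Ideal.span_insert, Ideal.span_insert, Ideal.span_singleton_eq_span_singleton.2 hf,
    Ideal.span_singleton_eq_span_singleton.2 hg]

theorem inter_eq_zero_of_isUnit {f g : PS} (hf : IsUnit f) : inter f g = 0 := by
  have : Ideal.span {f, g} = ⊤ := Ideal.eq_top_of_isUnit_mem _ (Ideal.subset_span (by simp)) hf
  rw [inter, this]
  exact Module.finrank_zero_of_subsingleton

end PS

end PlaneCurve

/-! ### Smooth branches, normal forms and unique factorization -/

namespace PlaneCurve

namespace PS

open MvPowerSeries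

theorem X_dvd_iff_one_le_weightedOrder (i : Fin 2) (f : PS) :
    (X i : PS) ∣ f ↔ 1 ≤ f.weightedOrder (Pi.single i 1 : Fin 2 → ℕ) := by
  have hw : ∀ d : Fin 2 →₀ ℕ, Finsupp.weight (Pi.single i 1 : Fin 2 → ℕ) d = d i := fun d => by
    rw [Finsupp.weight_apply, Finsupp.sum_fintype _ _ (by simp)]
    simp [Pi.single_apply]
  rw [X_dvd_iff]
  constructor
  · intro h
    exact_mod_cast nat_le_weightedOrder _ (n := 1) fun d hd => h d (by rw [hw] at hd; omega)
  · intro h d hd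
    refine coeff_eq_zero_of_lt_weightedOrder (Pi.single i 1 : Fin 2 → ℕ) (lt_of_lt_of_le ?_ h)
    rw [hw, hd]
    simp

theorem X_prime (i : Fin 2) : Prime (X i : PS) := by
  refine ⟨fun h => ?_, fun h => isUnit_iff.1 h (constantCoeff_X i), fun a b hab => ?_⟩
  · have : coeff (Finsupp.single i 1) (X i : PS) = 0 := by rw [h, map_zero]
    simp at this
  · simp only [X_dvd_iff_one_le_weightedOrder] at hab ⊢
    rw [weightedOrder_mul] at hab
    by_contra! h
    rw [Order.lt_one_iff, Order.lt_one_iff] at h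
    rw [h.1, h.2] at hab
    simp at hab

/-- The smooth branch `x = c y ^ r`. -/
noncomputable def branch (c : ℂ) (r : ℕ) : PS := X 0 - C c * X 1 ^ r

theorem algHom_C (φ : PS →ₐ[ℂ] PS) (c : ℂ) : φ (C c) = C c := by
  have := φ.commutes c
  simpa [MvPowerSeries.algebraMap_apply] using this

/-- The shear `x ↦ x - c y ^ r` is an automorphism straightening the branch `x = c y ^ r`. -/
theorem exists_shear (c : ℂ) {r : ℕ} (hr : r ≠ 0) :
    ∃ φ : PS ≃ₐ[ℂ] PS, φ (X 0) = branch c r ∧ φ (X 1) = X 1 := by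
  have h : ∀ c : ℂ, ∀ i, constantCoeff ((![branch c r, X 1] : Fin 2 → PS) i) = 0 := by
    intro c i
    fin_cases i <;> simp [branch, hr]
  have h2 : ∀ c : ℂ, ∀ i, substHom ![branch c r, X 1] (h c)
      ((![branch (-c) r, X 1] : Fin 2 → PS) i) = X i := by
    intro c i
    have h0 : substHom _ (h c) (X 0) = branch c r := substHom_X _ (h c) 0
    have h1 : substHom _ (h c) (X 1) = X 1 := substHom_X _ (h c) 1
    fin_cases i
    · simp only [Fin.zero_eta, Matrix.cons_val_zero]
      have e : branch (-c) r = X 0 - C (-c) * X 1 ^ r := rfl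
      rw [e, map_sub, map_mul, map_pow, h0, h1, algHom_C, branch, map_neg]
      ring
    · exact h1
  refine ⟨substEquiv ![branch c r, X 1] ![branch (-c) r, X 1] (h c) (h (-c)) (h2 c) ?_, ?_, ?_⟩
  · simpa using h2 (-c)
  · exact substHom_X _ (h c) 0
  · exact substHom_X _ (h c) 1

theorem branch_prime (c : ℂ) {r : ℕ} (hr : r ≠ 0) : Prime (branch c r) := by
  obtain ⟨φ, h0, -⟩ := exists_shear c hr
  rw [← h0]
  exact (MulEquiv.prime_iff φ.toMulEquiv).2 (X_prime 0)

theorem isUnit_C {c : ℂ} (hc : c ≠ 0) : IsUnit (C c : PS) :=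
  isUnit_iff.2 (by simpa using hc)

theorem inter_add_mul_right (f g h : PS) : inter f (g + h * f) = inter f g :=
  inter_congr (Ideal.span_pair_add_mul_left _ _ _)

/-- Two branches `x = c y ^ r`, `x = c' y ^ r` have contact of order `r`; the factor `y ^ s`
adds `s` to the intersection number. -/
theorem inter_branch_branch {c c' : ℂ} (h : c ≠ c') {r : ℕ} (hr : r ≠ 0) (s : ℕ) :
    inter (branch c r) (X 1 ^ s * branch c' r) = s + r := by
  obtain ⟨φ, h0, h1⟩ := exists_shear c hr
  have hφ : X 1 ^ s * branch c' r = φ (X 1 ^ s * branch (c' - c) r) := by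
    have hC : φ (C (c' - c)) = C (c' - c) := algHom_C φ.toAlgHom _
    rw [map_mul, map_pow, h1, branch, branch, map_sub, map_mul, map_pow, h1, h0, hC, branch, map_sub]
    ring
  rw [← h0, hφ, inter_map]
  have e : X 1 ^ s * branch (c' - c) r = C (c - c') * X 1 ^ (s + r) + X 1 ^ s * X 0 := by
    rw [branch, map_sub, map_sub]
    ring
  rw [e, inter_add_mul_right]
  have := inter_X_pow 1 (s + r)
  rw [pow_one, one_mul] at this
  refine Eq.trans ?_ this
  exact inter_of_associated (Associated.refl _)
    (associated_unit_mul_left _ _ (isUnit_C (sub_ne_zero.2 h)))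

theorem inter_X_one_branch_mul (c c' : ℂ) {r : ℕ} (hr : r ≠ 0) :
    inter (X 1) (branch c r * branch c' r) = 2 := by
  obtain ⟨r, rfl⟩ := Nat.exists_eq_succ_of_ne_zero hr
  have e : branch c (r + 1) * branch c' (r + 1) = X 0 ^ 2 +
      (C c * C c' * X 1 ^ (r + 1) * X 1 ^ r - (C c + C c') * X 0 * X 1 ^ r) * X 1 := by
    rw [branch, branch]
    ring
  rw [Nat.succ_eq_add_one, e, inter_add_mul_right, inter_comm]
  simpa using inter_X_pow 2 1

/-- The branches of `A_{2r-1}`. -/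
noncomputable def branchesA (r : ℕ) : Fin 2 → PS := ![branch Complex.I r, branch (-Complex.I) r]

/-- The branches of `D_{2r+2}`. -/
noncomputable def branchesD (r : ℕ) : Fin 3 → PS :=
  ![X 1, branch Complex.I r, branch (-Complex.I) r]

theorem branch_I_mul (r : ℕ) :
    branch Complex.I r * branch (-Complex.I) r = X 0 ^ 2 + X 1 ^ (2 * r) := by
  have : (C Complex.I : PS) * C Complex.I = -1 := by
    rw [← map_mul, Complex.I_mul_I, map_neg, map_one]
  rw [branch, branch, map_neg]
  linear_combination (-(X 1 ^ (2 * r) : PS)) * this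

theorem prod_branchesA {m r : ℕ} (h : m + 1 = 2 * r) : ∏ i, branchesA r i = normalFormA m := by
  rw [normalFormA, h, ← branch_I_mul, Fin.prod_univ_two]
  rfl

theorem prod_branchesD {m r : ℕ} (h : m = 2 * r + 2) : ∏ i, branchesD r i = normalFormD m := by
  have : m - 1 = 2 * r + 1 := by omega
  rw [normalFormD, this, Fin.prod_univ_three]
  change X 1 * branch Complex.I r * branch (-Complex.I) r = _
  rw [mul_assoc, branch_I_mul]
  ring

theorem branchesA_prime {r : ℕ} (hr : r ≠ 0) (i : Fin 2) : Prime (branchesA r i) := by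
  fin_cases i <;> exact branch_prime _ hr

theorem branchesD_prime {r : ℕ} (hr : r ≠ 0) (i : Fin 3) : Prime (branchesD r i) := by
  fin_cases i
  · exact X_prime 1
  · exact branch_prime _ hr
  · exact branch_prime _ hr

/-- The sum, over the members of a finite family of series, of the intersection number of the
member with the product of the others. -/
noncomputable def totalInter {ι : Type*} [Fintype ι] [DecidableEq ι] (f : ι → PS) : ℕ :=
  ∑ i, inter (f i) (∏ j ∈ Finset.univ.erase i, f j)

theorem I_ne_neg_I : Complex.I ≠ -Complex.I := by
  intro h
  exact Complex.I_ne_zero (self_eq_neg.1 h)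

theorem totalInter_branchesA {r : ℕ} (hr : r ≠ 0) : totalInter (branchesA r) = 2 * r := by
  have h1 := inter_branch_branch I_ne_neg_I hr 0
  have h2 := inter_branch_branch I_ne_neg_I.symm hr 0
  simp only [pow_zero, one_mul, zero_add] at h1 h2
  have e0 : (Finset.univ.erase 0 : Finset (Fin 2)) = {1} := by decide
  have e1 : (Finset.univ.erase 1 : Finset (Fin 2)) = {0} := by decide
  rw [totalInter, Fin.sum_univ_two, e0, e1, Finset.prod_singleton, Finset.prod_singleton]
  change inter (branch _ r) (branch _ r) + inter (branch _ r) (branch _ r) = _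
  rw [h1, h2, two_mul]

theorem totalInter_branchesD {r : ℕ} (hr : r ≠ 0) : totalInter (branchesD r) = 2 * r + 4 := by
  have h1 := inter_branch_branch I_ne_neg_I hr 1
  have h2 := inter_branch_branch I_ne_neg_I.symm hr 1
  have h0 := inter_X_one_branch_mul Complex.I (-Complex.I) hr
  simp only [pow_one] at h1 h2
  have e0 : (Finset.univ.erase 0 : Finset (Fin 3)) = {1, 2} := by decide
  have e1 : (Finset.univ.erase 1 : Finset (Fin 3)) = {0, 2} := by decide
  have e2 : (Finset.univ.erase 2 : Finset (Fin 3)) = {0, 1} := by decide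
  rw [totalInter, Fin.sum_univ_three, e0, e1, e2, Finset.prod_pair (by decide),
    Finset.prod_pair (by decide), Finset.prod_pair (by decide)]
  change inter (X 1) (branch _ r * branch _ r) + inter (branch _ r) (X 1 * branch _ r) +
    inter (branch _ r) (X 1 * branch _ r) = _
  rw [h0, h1, h2]
  ring

theorem prime_of_irreducible_of_dvd_prod {α : Type*} [CommMonoidWithZero α] [IsCancelMulZero α]
    {f : α} (hf : Irreducible f) (s : Multiset α) (hs : ∀ p ∈ s, Prime p) (h : f ∣ s.prod) :
    Prime f := by
  induction s using Multiset.induction_on with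
  | empty => exact absurd (isUnit_of_dvd_one (by simpa using h)) hf.not_isUnit
  | cons p t ih =>
    obtain ⟨u, hu⟩ := h
    rw [Multiset.prod_cons] at hu
    have hp : Prime p := hs p (Multiset.mem_cons_self p t)
    rcases hp.dvd_or_dvd (Dvd.intro _ hu) with h1 | ⟨v, rfl⟩
    · exact (hp.irreducible.associated_of_dvd hf h1).prime hp
    · refine ih (fun q hq => hs q (Multiset.mem_cons_of_mem hq)) ⟨v, ?_⟩
      refine mul_left_cancel₀ hp.ne_zero ?_
      rw [hu]
      exact mul_left_comm _ _ _

/-- The intersection number of a factor of `h`, given up to associates, with its cofactor (`0` for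
a class that does not divide `h`). It depends on the class only, which turns the total intersection
number of a factorization of `h` into a sum over a multiset of classes of associates. -/
noncomputable def cofactorInter (h : PS) (a : Associates PS) : ℕ :=
  open Classical in
  if H : ∃ fg : PS × PS, Associates.mk fg.1 = a ∧ Associated (fg.1 * fg.2) h then
    inter H.choose.1 H.choose.2 else 0

theorem cofactorInter_mk {h f g : PS} (h0 : h ≠ 0) (hfg : Associated (f * g) h) :
    cofactorInter h (Associates.mk f) = inter f g := by
  have H : ∃ fg : PS × PS, Associates.mk fg.1 = Associates.mk f ∧ Associated (fg.1 * fg.2) h :=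
    ⟨(f, g), rfl, hfg⟩
  rw [cofactorInter, dif_pos H]
  obtain ⟨h1, h2⟩ := H.choose_spec
  have h3 : Associated H.choose.1 f := Associates.mk_eq_mk_iff_associated.1 h1
  refine inter_of_associated h3 (Associated.of_mul_left (h2.trans hfg.symm) h3 ?_)
  intro hz
  rw [hz, zero_mul] at h2
  exact h0 (h2.eq_zero_iff.1 rfl)

theorem totalInter_eq_sum_cofactorInter {ι : Type*} [Fintype ι] [DecidableEq ι] (f : ι → PS)
    {h : PS} (h0 : h ≠ 0) (hf : Associated (∏ i, f i) h) :
    totalInter f = ((Finset.univ.val.map fun i => Associates.mk (f i)).map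
      (cofactorInter h)).sum := by
  rw [Multiset.map_map]
  refine Finset.sum_congr rfl fun i _ => (cofactorInter_mk h0 ?_).symm
  rwa [Finset.mul_prod_erase _ _ (Finset.mem_univ i)]

/-- Unique factorization: if the product of a family of units and irreducible series is
associated to a product of primes, then the number of non-units and the total intersection number
are those of the family of primes. -/
theorem card_and_totalInter_eq {ι κ : Type*} [Fintype ι] [DecidableEq ι] [Fintype κ]
    [DecidableEq κ] (f : ι → PS) (q : κ → PS) (hf : ∀ i, ¬IsUnit (f i) → Irreducible (f i))
    (hq : ∀ j, Prime (q j)) (h : Associated (∏ i, f i) (∏ j, q j)) :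
    {i | ¬IsUnit (f i)}.ncard = Fintype.card κ ∧ totalInter f = totalInter q := by
  classical
  have h0 : ∏ j, q j ≠ 0 := Finset.prod_ne_zero_iff.2 fun j _ => (hq j).ne_zero
  have hq' : ∀ x ∈ Finset.univ.val.map q, Prime x := by simpa using hq
  set N : Finset ι := Finset.univ.filter fun i => ¬IsUnit (f i) with hN
  have hf' : ∀ x ∈ N.val.map f, Prime x := by
    intro x hx
    obtain ⟨i, hi, rfl⟩ := Multiset.mem_map.1 hx
    have hi' : ¬IsUnit (f i) := (Finset.mem_filter.1 hi).2
    refine prime_of_irreducible_of_dvd_prod (hf i hi') _ hq' ?_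
    exact (Finset.dvd_prod_of_mem f (Finset.mem_univ i)).trans h.dvd
  have hu : IsUnit (∏ i ∈ Finset.univ.filter fun i => IsUnit (f i), f i) := by
    rw [IsUnit.prod_iff]
    intro i hi
    exact (Finset.mem_filter.1 hi).2
  have hprod : Associated (N.val.map f).prod (Finset.univ.val.map q).prod := by
    refine Associated.trans ?_ h
    rw [← Finset.prod_filter_mul_prod_filter_not Finset.univ fun i => IsUnit (f i)]
    exact associated_unit_mul_right _ _ hu
  have hrel := prime_factors_unique hf' hq' hprod
  have hmap : (N.val.map fun i => Associates.mk (f i)) =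
      Finset.univ.val.map fun j => Associates.mk (q j) := by
    have h1 : Multiset.Rel (· = ·) ((N.val.map f).map Associates.mk)
        ((Finset.univ.val.map q).map Associates.mk) := by
      rw [Multiset.rel_map]
      exact hrel.mono fun a _ b _ hab => Associates.mk_eq_mk_iff_associated.2 hab
    rw [Multiset.rel_eq, Multiset.map_map, Multiset.map_map] at h1
    exact h1
  constructor
  · have h1 := congrArg Multiset.card hmap
    simp only [Multiset.card_map, Finset.card_val, Finset.card_univ] at h1
    rw [← h1, ← Set.ncard_coe_finset]
    congr 1
    ext i
    simp [hN]
  · rw [totalInter_eq_sum_cofactorInter q h0 (Associated.refl _), ← hmap, Multiset.map_map]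
    change ∑ i, _ = ∑ i ∈ N, _
    rw [hN, Finset.sum_filter]
    refine Finset.sum_congr rfl fun i _ => ?_
    split_ifs with hi
    · exact inter_eq_zero_of_isUnit hi
    · rw [Function.comp_apply, cofactorInter_mk h0]
      rwa [Finset.mul_prod_erase _ _ (Finset.mem_univ i)]

end PS

end PlaneCurve

/-! ### Local equations in different projective frames -/

namespace PlaneCurve

open MvPowerSeries

/-- The homogeneous coordinates `(1, x, y)`. -/
noncomputable def homCoord : Fin 3 → PS := ![1, X 0, X 1]

/-- The matrix whose rows are `v, a, b`. -/
def frame (v a b : Fin 3 → ℂ) : Matrix (Fin 3) (Fin 3) ℂ := Matrix.of ![v, a, b]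

/-- The vector `v + x • a + y • b` over `ℂ⟦x, y⟧`, where `v, a, b` are the rows of the matrix. -/
noncomputable def chart (B : Matrix (Fin 3) (Fin 3) ℂ) : Fin 3 → PS :=
  Matrix.vecMul homCoord (B.map C)

theorem chart_apply (B : Matrix (Fin 3) (Fin 3) ℂ) (i : Fin 3) :
    chart B i = C (B 0 i) + C (B 1 i) * X 0 + C (B 2 i) * X 1 := by
  simp [chart, Matrix.vecMul, dotProduct, Fin.sum_univ_three, homCoord]
  ring

theorem chart_one : chart 1 = homCoord := by
  rw [chart, Matrix.map_one _ (map_zero _) (map_one _), Matrix.vecMul_one]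

theorem chart_mul (A B : Matrix (Fin 3) (Fin 3) ℂ) :
    chart (A * B) = Matrix.vecMul (chart A) (B.map C) := by
  rw [chart, chart, Matrix.vecMul_vecMul, Matrix.map_mul]

theorem localEquation_eq_aeval (F : MvPolynomial (Fin 3) ℂ) (v a b : Fin 3 → ℂ) :
    localEquation F v a b = MvPolynomial.aeval (chart (frame v a b)) F := by
  have h : ∀ p : MvPolynomial (Fin 2) ℂ,
      (p : PS) = MvPolynomial.coeToMvPowerSeries.algHom ℂ p := fun p => by simp
  rw [localEquation, h, ← AlgHom.comp_apply, MvPolynomial.comp_aeval]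
  congr 2
  funext i
  rw [chart_apply, ← h]
  simp [frame]

theorem algHom_chart (φ : PS →ₐ[ℂ] PS) (B : Matrix (Fin 3) (Fin 3) ℂ) :
    (fun i => φ (chart B i)) = Matrix.vecMul (fun k => φ (homCoord k)) (B.map C) := by
  funext i
  simp [chart, Matrix.vecMul, dotProduct, PS.algHom_C]

theorem aeval_mul_of_isHomogeneous {σ R : Type*} [CommRing R] [Algebra ℂ R]
    {F : MvPolynomial σ ℂ} {n : ℕ} (hF : F.IsHomogeneous n) (w : R) (y : σ → R) :
    MvPolynomial.aeval (fun i => w * y i) F = w ^ n * MvPolynomial.aeval y F := by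
  rw [MvPolynomial.aeval_def, MvPolynomial.aeval_def, MvPolynomial.eval₂_eq, MvPolynomial.eval₂_eq,
    Finset.mul_sum]
  refine Finset.sum_congr rfl fun d hd => ?_
  simp only [mul_pow]
  rw [Finset.prod_mul_distrib, Finset.prod_pow_eq_pow_sum, hF.degree_eq_sum_deg_support hd]
  ring

/-- Passing to another projective frame with the same first point is a substitution of the affine
coordinates `x, y`, up to a unit factor of the homogeneous coordinates. -/
theorem exists_substHom_of_frame {A : Matrix (Fin 3) (Fin 3) ℂ} (h0 : A 0 0 ≠ 0)
    (h1 : A 0 1 = 0) (h2 : A 0 2 = 0) :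
    ∃ (s : Fin 2 → PS) (hs : ∀ i, constantCoeff (s i) = 0) (w : PS), IsUnit w ∧
      ∀ k, chart A k = w * PS.substHom s hs (homCoord k) := by
  have hw : constantCoeff (chart A 0) ≠ 0 := by simpa [chart_apply] using h0
  have hc : ∀ i : Fin 2, constantCoeff ((chart A 0)⁻¹ * chart A i.succ) = 0 := by
    intro i
    fin_cases i <;> simp [chart_apply, h1, h2]
  refine ⟨_, hc, chart A 0, PS.isUnit_iff.2 hw, fun k => ?_⟩
  have key : ∀ i : Fin 2, chart A i.succ =
      chart A 0 * PS.substHom _ hc (X i) := by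
    intro i
    rw [PS.substHom_X, ← mul_assoc, MvPowerSeries.mul_inv_cancel _ hw, one_mul]
  fin_cases k
  · simp [homCoord]
  · exact key 0
  · exact key 1

theorem exists_algEquiv_of_frame {A A' : Matrix (Fin 3) (Fin 3) ℂ} (hA : A * A' = 1)
    (hA' : A' * A = 1) (h0 : A 0 0 ≠ 0) (h1 : A 0 1 = 0) (h2 : A 0 2 = 0) :
    ∃ (φ : PS ≃ₐ[ℂ] PS) (w : PS), IsUnit w ∧ ∀ k, chart A k = w * φ (homCoord k) := by
  have e0 : A 0 0 * A' 0 0 = 1 := by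
    have := congr_fun (congr_fun hA 0) 0
    simpa [Matrix.mul_apply, Fin.sum_univ_three, h1, h2] using this
  have e1 : A' 0 1 = 0 := by
    have := congr_fun (congr_fun hA 0) 1
    simpa [Matrix.mul_apply, Fin.sum_univ_three, h1, h2, h0] using this
  have e2 : A' 0 2 = 0 := by
    have := congr_fun (congr_fun hA 0) 2
    simpa [Matrix.mul_apply, Fin.sum_univ_three, h1, h2, h0] using this
  obtain ⟨s, hs, w, hw, hsw⟩ := exists_substHom_of_frame h0 h1 h2
  obtain ⟨t, ht, z, hz, htz⟩ := exists_substHom_of_frame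
    (right_ne_zero_of_mul_eq_one e0) e1 e2
  -- Substituting one change of frame into the other gives the identity, because the matrices are
  -- inverse to each other and the first coordinate fixes the scaling factor.
  have key : ∀ {A A' : Matrix (Fin 3) (Fin 3) ℂ} (_ : A * A' = 1) {s t : Fin 2 → PS}
      {hs : ∀ i, constantCoeff (s i) = 0} {ht : ∀ i, constantCoeff (t i) = 0} {w z : PS}
      (_ : ∀ k, chart A k = w * PS.substHom s hs (homCoord k))
      (_ : ∀ k, chart A' k = z * PS.substHom t ht (homCoord k)),
      ∀ i, PS.substHom s hs (t i) = X i := by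
    intro A A' hA s t hs ht w z hsw htz
    set φ := PS.substHom s hs
    have h : ∀ k, homCoord k = w * φ z * φ (PS.substHom t ht (homCoord k)) := by
      intro k
      have h3 := congr_fun (algHom_chart φ A') k
      simp only [htz, map_mul] at h3
      have h4 : homCoord k = Matrix.vecMul (chart A) (A'.map C) k := by
        rw [← chart_mul, hA, chart_one]
      rw [mul_assoc, h3, h4]
      have h5 : chart A = w • fun k => φ (homCoord k) := funext hsw
      rw [h5, Matrix.smul_vecMul]
      rfl
    have h6 : w * φ z = 1 := by
      have := h 0
      simp only [homCoord, Matrix.cons_val_zero, map_one, mul_one] at this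
      exact this.symm
    intro i
    have h7 := h i.succ
    rw [h6, one_mul] at h7
    have h8 : homCoord i.succ = X i := by fin_cases i <;> rfl
    rw [h8, PS.substHom_X] at h7
    exact h7.symm
  exact ⟨PS.substEquiv s t hs ht (key hA hsw htz) (key hA' htz hsw), w, hw, hsw⟩

/-- The local equations of plane curves at the same point in two projective frames differ by an
automorphism of `ℂ⟦x, y⟧`, common to all curves, and a unit factor. -/
theorem exists_algEquiv_localEquation {v a b v' a' b' : Fin 3 → ℂ}
    (h : LinearIndependent ℂ ![v, a, b]) (h' : LinearIndependent ℂ ![v', a', b']) {c : ℂ}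
    (hc : c ≠ 0) (hv : v' = c • v) :
    ∃ φ : PS ≃ₐ[ℂ] PS, ∀ (F : MvPolynomial (Fin 3) ℂ) (n : ℕ), F.IsHomogeneous n →
      Associated (localEquation F v' a' b') (φ (localEquation F v a b)) := by
  have hB : IsUnit (frame v a b) := Matrix.linearIndependent_rows_iff_isUnit.1 h
  have hB' : IsUnit (frame v' a' b') := Matrix.linearIndependent_rows_iff_isUnit.1 h'
  have hBd := (Matrix.isUnit_iff_isUnit_det _).1 hB
  have hBd' := (Matrix.isUnit_iff_isUnit_det _).1 hB'
  set B := frame v a b with hBdef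
  set B' := frame v' a' b' with hBdef'
  have hrow : ∀ k, (B' * B⁻¹) 0 k = c * (1 : Matrix (Fin 3) (Fin 3) ℂ) 0 k := by
    intro k
    have : B' 0 = c • B 0 := hv
    rw [← Matrix.mul_nonsing_inv B hBd, Matrix.mul_apply, Matrix.mul_apply, Finset.mul_sum]
    refine Finset.sum_congr rfl fun j _ => ?_
    rw [this, Pi.smul_apply, smul_eq_mul, mul_assoc]
  obtain ⟨φ, w, hw, hφ⟩ := exists_algEquiv_of_frame (A := B' * B⁻¹) (A' := B * B'⁻¹)
    (by rw [mul_assoc, ← mul_assoc B⁻¹, Matrix.nonsing_inv_mul B hBd, one_mul,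
      Matrix.mul_nonsing_inv B' hBd'])
    (by rw [mul_assoc, ← mul_assoc B'⁻¹, Matrix.nonsing_inv_mul B' hBd', one_mul,
      Matrix.mul_nonsing_inv B hBd])
    (by simpa [hrow] using hc) (by simp [hrow]) (by simp [hrow])
  refine ⟨φ, fun F n hF => ?_⟩
  have e : chart B' = fun i => w * φ (chart B i) := by
    have h1 : B' = B' * B⁻¹ * B := by rw [mul_assoc, Matrix.nonsing_inv_mul B hBd, mul_one]
    have h2 : chart (B' * B⁻¹) = w • fun k => φ (homCoord k) := funext hφ
    rw [h1, chart_mul, h2, Matrix.smul_vecMul]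
    have h3 := algHom_chart φ.toAlgHom B
    exact congrArg (w • ·) h3.symm
  rw [localEquation_eq_aeval, localEquation_eq_aeval, ← hBdef, ← hBdef', e,
    aeval_mul_of_isHomogeneous hF]
  have h4 : φ (MvPolynomial.aeval (chart B) F) =
      MvPolynomial.aeval (fun i => φ (chart B i)) F := by
    have := MvPolynomial.comp_aeval_apply (chart B) φ.toAlgHom F
    exact this
  rw [h4]
  exact associated_unit_mul_left _ _ (hw.pow n)

theorem constantCoeff_aeval (V : Fin 3 → PS) (F : MvPolynomial (Fin 3) ℂ) :
    constantCoeff (MvPolynomial.aeval V F) =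
      MvPolynomial.eval (fun i => constantCoeff (V i)) F := by
  induction F using MvPolynomial.induction_on with
  | C a => simp [MvPowerSeries.algebraMap_apply]
  | add p q hp hq => simp only [map_add, hp, hq]
  | mul_X p i hp => simp only [map_mul, MvPolynomial.aeval_X, MvPolynomial.eval_X, hp]

/-- The chain rule for the linear coefficients of `F` evaluated at power series. -/
theorem coeff_single_aeval (V : Fin 3 → PS) (F : MvPolynomial (Fin 3) ℂ) (j : Fin 2) :
    coeff (Finsupp.single j 1) (MvPolynomial.aeval V F) =
      ∑ i, MvPolynomial.eval (fun i => constantCoeff (V i)) (MvPolynomial.pderiv i F) *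
        coeff (Finsupp.single j 1) (V i) := by
  classical
  induction F using MvPolynomial.induction_on with
  | C a => simp [MvPowerSeries.algebraMap_apply, coeff_C]
  | add p q hp hq => simp only [map_add, hp, hq, add_mul, Finset.sum_add_distrib]
  | mul_X p i hp =>
    rw [map_mul, PS.coeff_single_mul, constantCoeff_aeval, hp]
    simp only [MvPolynomial.aeval_X, Derivation.leibniz, MvPolynomial.pderiv_X, smul_eq_mul,
      map_add, map_mul, MvPolynomial.eval_X, add_mul, Finset.sum_add_distrib]
    congr 1
    · rw [Finset.sum_eq_single i (fun k _ hk => by simp [hk.symm]) (by simp)]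
      simp
    · rw [Finset.sum_mul]
      exact Finset.sum_congr rfl fun k _ => by ring

theorem constantCoeff_chart (v a b : Fin 3 → ℂ) :
    (fun i => constantCoeff (chart (frame v a b) i)) = v := by
  funext i
  simp [chart_apply, frame]

theorem constantCoeff_localEquation (F : MvPolynomial (Fin 3) ℂ) (v a b : Fin 3 → ℂ) :
    constantCoeff (localEquation F v a b) = MvPolynomial.eval v F := by
  rw [localEquation_eq_aeval, constantCoeff_aeval, constantCoeff_chart]

theorem coeff_localEquation (F : MvPolynomial (Fin 3) ℂ) (v a b : Fin 3 → ℂ) (j : Fin 2) :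
    coeff (Finsupp.single j 1) (localEquation F v a b) =
      ∑ i, MvPolynomial.eval v (MvPolynomial.pderiv i F) * frame v a b j.succ i := by
  rw [localEquation_eq_aeval, coeff_single_aeval, constantCoeff_chart]
  refine Finset.sum_congr rfl fun i _ => ?_
  congr 1
  rw [chart_apply, map_add, map_add, PS.coeff_single_mul, PS.coeff_single_mul]
  fin_cases j <;> simp [coeff_C, coeff_X, Finsupp.single_left_inj]

theorem localEquation_prod {ι : Type*} (s : Finset ι) (F : ι → MvPolynomial (Fin 3) ℂ)
    (v a b : Fin 3 → ℂ) :
    localEquation (∏ i ∈ s, F i) v a b = ∏ i ∈ s, localEquation (F i) v a b := by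
  simp only [localEquation_eq_aeval, map_prod]

/-- By Euler's identity, the partial derivatives of a form vanish at a zero `v` as soon as the
linear part of the local equation does. -/
theorem eval_pderiv_eq_zero {F : MvPolynomial (Fin 3) ℂ} {n : ℕ} (hF : F.IsHomogeneous n)
    {v a b : Fin 3 → ℂ} (h : LinearIndependent ℂ ![v, a, b]) (h0 : MvPolynomial.eval v F = 0)
    (hj : ∀ j, coeff (Finsupp.single j 1) (localEquation F v a b) = 0) (i : Fin 3) :
    MvPolynomial.eval v (MvPolynomial.pderiv i F) = 0 := by
  have hB : IsUnit (frame v a b) := Matrix.linearIndependent_rows_iff_isUnit.1 h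
  have key : (frame v a b).mulVec
      (fun i => MvPolynomial.eval v (MvPolynomial.pderiv i F)) = 0 := by
    funext k
    rw [Matrix.mulVec, dotProduct, Pi.zero_apply]
    refine Fin.cases ?_ (fun j => ?_) k
    · have := congrArg (MvPolynomial.eval v) hF.sum_X_mul_pderiv
      simpa [h0, frame] using this
    · rw [← hj j, coeff_localEquation]
      exact Finset.sum_congr rfl fun i _ => mul_comm _ _
  have h1 : (fun i => MvPolynomial.eval v (MvPolynomial.pderiv i F)) = 0 :=
    Matrix.mulVec_injective_of_isUnit hB (by rw [key, Matrix.mulVec_zero])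
  exact congr_fun h1 i

/-- The local equation of a curve at a nonsingular point is irreducible. -/
theorem irreducible_localEquation {F : MvPolynomial (Fin 3) ℂ} {n : ℕ} (hF : F.IsHomogeneous n)
    {v a b : Fin 3 → ℂ} (h : LinearIndependent ℂ ![v, a, b]) (h0 : MvPolynomial.eval v F = 0)
    (hs : ∃ i, MvPolynomial.eval v (MvPolynomial.pderiv i F) ≠ 0) :
    Irreducible (localEquation F v a b) := by
  obtain ⟨i, hi⟩ := hs
  by_contra hirr
  refine hi (eval_pderiv_eq_zero hF h h0 (fun j => ?_) i)
  by_contra hj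
  exact hirr (PS.irreducible_of_coeff_ne_zero (by rw [constantCoeff_localEquation, h0]) hj)

end PlaneCurve

/-! ### Polynomials of bounded degree and their top forms -/

namespace PlaneCurve

/-- The coordinate ring of the affine plane. -/
abbrev Aff : Type := MvPolynomial (Fin 2) ℂ

namespace Aff

open MvPolynomial

/-- The polynomials all of whose monomials have degree less than `n`. -/
noncomputable def degLT (n : ℕ) : Submodule ℂ Aff := restrictSupport ℂ {s | s.degree < n}

theorem mem_degLT {n : ℕ} {p : Aff} : p ∈ degLT n ↔ ∀ s, n ≤ s.degree → coeff s p = 0 := by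
  rw [degLT, mem_restrictSupport_iff]
  constructor
  · intro h s hs
    by_contra hc
    exact absurd (h (mem_support_iff.2 hc)) (not_lt.2 hs)
  · intro h s hs
    by_contra hc
    exact mem_support_iff.1 hs (h s (not_lt.1 hc))

theorem degLT_mono {m n : ℕ} (h : m ≤ n) : degLT m ≤ degLT n :=
  restrictSupport_mono _ fun _ hs => lt_of_lt_of_le hs h

theorem eq_zero_of_mem_degLT_zero {p : Aff} (h : p ∈ degLT 0) : p = 0 := by
  ext s
  exact mem_degLT.1 h s (Nat.zero_le _)

theorem exists_mem_degLT (p : Aff) : ∃ n, p ∈ degLT n := by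
  refine ⟨p.totalDegree + 1, mem_degLT.2 fun s hs => ?_⟩
  by_contra hc
  have := le_totalDegree (mem_support_iff.2 hc)
  rw [Finsupp.degree_apply] at hs
  rw [Finsupp.sum] at this
  omega

theorem mul_mem_degLT {a b : ℕ} {p q : Aff} (hp : p ∈ degLT (a + 1)) (hq : q ∈ degLT b) :
    p * q ∈ degLT (a + b) := by
  classical
  rw [mem_degLT] at *
  intro s hs
  rw [coeff_mul]
  refine Finset.sum_eq_zero fun x hx => ?_
  have hx' : x.1.degree + x.2.degree = s.degree := by
    rw [← Finset.HasAntidiagonal.mem_antidiagonal.1 hx, map_add]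
  by_cases h : a + 1 ≤ x.1.degree
  · rw [hp _ h, zero_mul]
  · rw [hq _ (by omega), mul_zero]

theorem mem_degLT_of_isHomogeneous {n : ℕ} {p : Aff} (hp : p.IsHomogeneous n) :
    p ∈ degLT (n + 1) :=
  mem_degLT.2 fun s hs => hp.coeff_eq_zero (by omega)

theorem eq_zero_of_isHomogeneous_of_mem {n : ℕ} {p : Aff} (hp : p.IsHomogeneous n)
    (h : p ∈ degLT n) : p = 0 := by
  ext s
  by_cases hs : s.degree = n
  · exact mem_degLT.1 h s hs.ge
  · exact hp.coeff_eq_zero hs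

/-- `p'` is the homogeneous part of degree `n` of `p`, and `p` has degree at most `n`. -/
structure IsTop (n : ℕ) (p p' : Aff) : Prop where
  homogeneous : p'.IsHomogeneous n
  sub_mem : p - p' ∈ degLT n

theorem IsTop.mem {n : ℕ} {p p' : Aff} (h : IsTop n p p') : p ∈ degLT (n + 1) := by
  rw [← sub_add_cancel p p']
  exact add_mem (degLT_mono n.le_succ h.sub_mem) (mem_degLT_of_isHomogeneous h.homogeneous)

theorem IsTop.add {n : ℕ} {p p' q q' : Aff} (hp : IsTop n p p') (hq : IsTop n q q') :
    IsTop n (p + q) (p' + q') :=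
  ⟨hp.homogeneous.add hq.homogeneous, by
    rw [add_sub_add_comm]
    exact add_mem hp.sub_mem hq.sub_mem⟩

theorem IsTop.mul {m n : ℕ} {p p' q q' : Aff} (hp : IsTop m p p') (hq : IsTop n q q') :
    IsTop (m + n) (p * q) (p' * q') := by
  refine ⟨hp.homogeneous.mul hq.homogeneous, ?_⟩
  have e : p * q - p' * q' = q * (p - p') + p' * (q - q') := by ring
  rw [e]
  refine add_mem ?_ ?_
  · rw [add_comm m]
    exact mul_mem_degLT hq.mem hp.sub_mem
  · exact mul_mem_degLT (mem_degLT_of_isHomogeneous hp.homogeneous) hq.sub_mem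

theorem isTop_one : IsTop 0 1 1 := ⟨isHomogeneous_one _ _, by simp⟩

theorem IsTop.prod {ι : Type*} (s : Finset ι) {n : ι → ℕ} {p p' : ι → Aff}
    (h : ∀ i ∈ s, IsTop (n i) (p i) (p' i)) :
    IsTop (∑ i ∈ s, n i) (∏ i ∈ s, p i) (∏ i ∈ s, p' i) := by
  classical
  induction s using Finset.induction_on with
  | empty => exact isTop_one
  | insert a s ha ih =>
    rw [Finset.sum_insert ha, Finset.prod_insert ha, Finset.prod_insert ha]
    exact (h a (Finset.mem_insert_self a s)).mul
      (ih fun i hi => h i (Finset.mem_insert_of_mem hi))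

theorem IsTop.pow {n : ℕ} {p p' : Aff} (h : IsTop n p p') (k : ℕ) :
    IsTop (n * k) (p ^ k) (p' ^ k) := by
  have := IsTop.prod (Finset.range k) (fun _ _ => h)
  simpa [mul_comm] using this

theorem isTop_C (c : ℂ) : IsTop 0 (C c) (C c) := ⟨isHomogeneous_C _ _, by simp⟩

theorem isTop_zero (n : ℕ) : IsTop n 0 0 := ⟨isHomogeneous_zero _ _ _, by simp⟩

/-- The part of top degree of a form dehomogenized along `y = v + l`, with `v` constant and `l`
linear, is the value of the form at `l`. -/
theorem isTop_aeval {σ : Type*} {F : MvPolynomial σ ℂ} {n : ℕ} (hF : F.IsHomogeneous n)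
    {y l : σ → Aff} (h : ∀ i, IsTop 1 (y i) (l i)) : IsTop n (aeval y F) (aeval l F) := by
  classical
  rw [aeval_def, aeval_def, eval₂_eq, eval₂_eq]
  have key : ∀ d ∈ F.support, IsTop n (algebraMap ℂ Aff (coeff d F) * ∏ i ∈ d.support, y i ^ d i)
      (algebraMap ℂ Aff (coeff d F) * ∏ i ∈ d.support, l i ^ d i) := by
    intro d hd
    have := (isTop_C (coeff d F)).mul
      (IsTop.prod d.support (n := fun i => 1 * d i) fun i _ => (h i).pow (d i))
    simp only [one_mul, zero_add] at this
    rwa [← hF.degree_eq_sum_deg_support hd] at this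
  generalize F.support = s at key
  induction s using Finset.induction_on with
  | empty => simpa using isTop_zero n
  | insert a s ha ih =>
    rw [Finset.sum_insert ha, Finset.sum_insert ha]
    exact (key a (Finset.mem_insert_self a s)).add
      (ih fun i hi => key i (Finset.mem_insert_of_mem hi))

theorem isTop_homogeneousComponent {n : ℕ} {p : Aff} (h : p ∈ degLT (n + 1)) :
    IsTop n p (homogeneousComponent n p) := by
  refine ⟨homogeneousComponent_isHomogeneous n p, mem_degLT.2 fun s hs => ?_⟩
  rw [coeff_sub, coeff_homogeneousComponent]
  split_ifs with h1
  · exact sub_self _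
  · rw [mem_degLT.1 h s (by omega), sub_self]

/-- Cancellation: multiplication by a polynomial of exact degree `k` raises degrees by `k`. -/
theorem mem_degLT_of_mul_mem {k N : ℕ} {b g g' : Aff} (hg : IsTop k g g') (hg0 : g' ≠ 0)
    (h : b * g ∈ degLT (N + k)) : b ∈ degLT N := by
  obtain ⟨j, hj⟩ := exists_mem_degLT b
  induction j with
  | zero => exact degLT_mono (Nat.zero_le _) hj
  | succ s ih =>
    rcases Nat.lt_or_ge s N with hs | hs
    · exact degLT_mono hs hj
    · refine ih ?_
      have hb := isTop_homogeneousComponent hj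
      have h1 := hb.mul hg
      have h2 : homogeneousComponent s b * g' = 0 := by
        refine eq_zero_of_isHomogeneous_of_mem h1.homogeneous ?_
        have := sub_mem (degLT_mono (by omega : N + k ≤ s + k) h) h1.sub_mem
        rwa [sub_sub_cancel] at this
      have h3 : homogeneousComponent s b = 0 := (mul_eq_zero.1 h2).resolve_right hg0
      simpa [h3] using hb.sub_mem

theorem isTop_zero_iff {n : ℕ} {p : Aff} : IsTop n p 0 ↔ p ∈ degLT n :=
  ⟨fun h => by simpa using h.sub_mem, fun h => ⟨isHomogeneous_zero _ _ _, by simpa using h⟩⟩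

/-- If a form of degree `r` is divisible by a form of degree `k`, then the cofactor can be taken of
degree at most `r - k`; for `r < k` the truncated `r + 1 - k = 0` says that the cofactor is `0`. -/
theorem exists_cofactor_mem_degLT {k r : ℕ} {a g' : Aff} (ha : a.IsHomogeneous r)
    (hg : g'.IsHomogeneous k) (h : g' ∣ a) :
    ∃ c : Aff, c ∈ degLT (r + 1 - k) ∧ a = c * g' := by
  rcases eq_or_ne g' 0 with rfl | hg0
  · exact ⟨0, zero_mem _, by simpa using h⟩
  obtain ⟨c, hc⟩ := h
  rw [mul_comm] at hc
  refine ⟨c, ?_, hc⟩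
  have hg' : IsTop k g' g' := ⟨hg, by simp⟩
  refine mem_degLT_of_mul_mem hg' hg0 ?_
  rw [← hc]
  exact degLT_mono (by omega) (mem_degLT_of_isHomogeneous ha)

/-- Cancelling the leading forms: if `f'`, `g'` are coprime, an expression `a f + b g` whose degree
is smaller than expected is rewritten with `a` of the expected degree. -/
theorem exists_sub_mul_mem {m k N : ℕ} {f f' g g' : Aff} (hf : IsTop m f f') (hg : IsTop k g g')
    (hg0 : g' ≠ 0) (hrel : IsRelPrime g' f') (r : ℕ) :
    ∀ a b : Aff, a ∈ degLT r → a * f + b * g ∈ degLT (N + m) →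
      ∃ c ∈ degLT (r - k), a - c * g ∈ degLT N := by
  induction r with
  | zero =>
    intro a b ha _
    exact ⟨0, zero_mem _, by rw [zero_mul, sub_zero]; exact degLT_mono (Nat.zero_le _) ha⟩
  | succ r ih =>
    intro a b ha hab
    rcases Nat.lt_or_ge r N with hr | hr
    · exact ⟨0, zero_mem _, by rw [zero_mul, sub_zero]; exact degLT_mono hr ha⟩
    have hat := isTop_homogeneousComponent ha
    set a' := homogeneousComponent r a
    have haf := hat.mul hf
    have hab' : a * f + b * g ∈ degLT (r + m) := degLT_mono (by omega) hab
    have hdvd : g' ∣ a' := by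
      refine hrel.dvd_of_dvd_mul_right ?_
      have hbg : b * g ∈ degLT (r + m + 1) := by
        have := sub_mem (degLT_mono (Nat.le_succ _) hab') haf.mem
        rwa [add_sub_cancel_left] at this
      rcases Nat.lt_or_ge (r + m) k with hk | hk
      · have hb : b = 0 := by
          refine eq_zero_of_mem_degLT_zero (mem_degLT_of_mul_mem hg hg0 (degLT_mono ?_ hbg))
          omega
        rw [hb, zero_mul, add_zero] at hab'
        have : a' * f' = 0 := by
          refine eq_zero_of_isHomogeneous_of_mem haf.homogeneous ?_
          have := sub_mem hab' haf.sub_mem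
          rwa [sub_sub_cancel] at this
        rw [this]
        exact dvd_zero _
      · obtain ⟨s, hs⟩ := Nat.exists_eq_add_of_le' hk
        rw [hs, add_right_comm] at hbg
        have hbt := isTop_homogeneousComponent (mem_degLT_of_mul_mem hg hg0 hbg)
        have h1 := hbt.mul hg
        rw [← hs] at h1
        have h2 := haf.add h1
        have h3 : a' * f' + homogeneousComponent s b * g' = 0 := by
          refine eq_zero_of_isHomogeneous_of_mem h2.homogeneous ?_
          have := sub_mem hab' h2.sub_mem
          rwa [sub_sub_cancel] at this
        rw [eq_neg_of_add_eq_zero_left h3]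
        exact (Dvd.intro_left _ rfl).neg_right
    obtain ⟨c, hc, hac⟩ := exists_cofactor_mem_degLT hat.homogeneous hg.homogeneous hdvd
    have hacr : a - c * g ∈ degLT r := by
      rcases Nat.lt_or_ge r k with hk | hk
      · have hc0 : c = 0 := eq_zero_of_mem_degLT_zero (degLT_mono (by omega) hc)
        rw [hc0, zero_mul, sub_zero]
        rw [hc0, zero_mul] at hac
        exact isTop_zero_iff.1 (hac ▸ hat)
      · obtain ⟨s, rfl⟩ := Nat.exists_eq_add_of_le' hk
        have e : a - c * g = (a - a') - c * (g - g') := by rw [hac]; ring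
        rw [e]
        refine sub_mem hat.sub_mem (mul_mem_degLT (degLT_mono ?_ hc) hg.sub_mem)
        omega
    obtain ⟨c₂, hc₂, h⟩ := ih (a - c * g) (b + c * f) hacr (by
      have e : (a - c * g) * f + (b + c * f) * g = a * f + b * g := by ring
      rwa [e])
    refine ⟨c + c₂, add_mem hc (degLT_mono (by omega) hc₂), ?_⟩
    rw [add_mul, ← sub_sub]
    exact h

/-- Forms in two variables without a common zero on the projective line are coprime. -/
theorem isRelPrime_of_forall_eval {f g : Aff}
    (h : ∀ x : Fin 2 → ℂ, eval x f = 0 → eval x g = 0 → x = 0) : IsRelPrime f g := by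
  intro d hdf hdg
  have key : ∀ i : Fin 2, ∃ N : ℕ, d ∣ X i ^ N := by
    intro i
    have h1 : (X i : Aff) ∈ (Ideal.span {d}).radical := by
      rw [← vanishingIdeal_zeroLocus_eq_radical (K := ℂ), mem_vanishingIdeal_iff]
      intro x hx
      have hxd : eval x d = 0 := by
        simpa [aeval_eq_eval] using hx d (Ideal.mem_span_singleton_self d)
      have hx0 := h x (by obtain ⟨u, rfl⟩ := hdf; rw [map_mul, hxd, zero_mul])
        (by obtain ⟨u, rfl⟩ := hdg; rw [map_mul, hxd, zero_mul])
      simp [hx0]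
    obtain ⟨N, hN⟩ := h1
    exact ⟨N, Ideal.mem_span_singleton.1 hN⟩
  obtain ⟨N, hN⟩ := key 0
  obtain ⟨M, hM⟩ := key 1
  obtain ⟨i, -, hi⟩ := (dvd_prime_pow (X_prime (i := (0 : Fin 2))) N).1 hN
  rcases Nat.eq_zero_or_pos i with rfl | hi0
  · exact (associated_one_iff_isUnit.1 (by simpa using hi))
  · have h1 : (X 0 : Aff) ∣ X 1 ^ M := (dvd_pow_self _ hi0.ne').trans (hi.symm.dvd.trans hM)
    have h2 := (X_prime (R := ℂ) (i := (0 : Fin 2))).dvd_of_dvd_pow h1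
    rw [X_dvd_X] at h2
    exact absurd h2 (by decide)

theorem two_mul_finrank_degLT (n : ℕ) : 2 * Module.finrank ℂ (degLT n) = n * (n + 1) := by
  classical
  let e : (Σ _ : ℕ, ℕ) → (Fin 2 →₀ ℕ) := fun x =>
    Finsupp.single 0 x.2 + Finsupp.single 1 (x.1 - x.2)
  let S : Finset (Σ _ : ℕ, ℕ) := (Finset.range n).sigma fun j => Finset.range (j + 1)
  have hdeg : ∀ s : Fin 2 →₀ ℕ, s.degree = s 0 + s 1 := fun s => by
    rw [Finsupp.degree_eq_sum, Fin.sum_univ_two]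
  have he0 : ∀ x, e x 0 = x.2 := fun x => by simp [e]
  have he1 : ∀ x, e x 1 = x.1 - x.2 := fun x => by simp [e]
  have hS : {s : Fin 2 →₀ ℕ | s.degree < n} = ↑(S.image e) := by
    ext s
    simp only [Set.mem_ofPred_eq, Finset.coe_image, Set.mem_image, Finset.mem_coe, S,
      Finset.mem_sigma, Finset.mem_range, hdeg]
    constructor
    · intro hs
      refine ⟨⟨s 0 + s 1, s 0⟩, ⟨hs, Nat.lt_succ_of_le (Nat.le_add_right _ _)⟩, ?_⟩
      ext i
      fin_cases i
      · exact he0 _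
      · exact (he1 _).trans (by simp)
    · rintro ⟨x, ⟨hx1, hx2⟩, rfl⟩
      rw [he0, he1]
      omega
  have hinj : Set.InjOn e S := by
    rintro ⟨a, b⟩ hx ⟨a', b'⟩ hy hxy
    simp only [S, Finset.coe_sigma, Set.mem_sigma_iff, Finset.mem_coe, Finset.mem_range] at hx hy
    have h0 : b = b' := (he0 ⟨a, b⟩).symm.trans (hxy ▸ he0 ⟨a', b'⟩)
    have h1 : a - b = a' - b' := (he1 ⟨a, b⟩).symm.trans (hxy ▸ he1 ⟨a', b'⟩)
    have h2 : a = a' := by omega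
    rw [h0, h2]
  have h1 := Module.finrank_eq_nat_card_basis
    (basisRestrictSupport ℂ {s : Fin 2 →₀ ℕ | s.degree < n})
  have h2 : Nat.card {s : Fin 2 →₀ ℕ | s.degree < n} = S.card := by
    rw [hS]
    rw [Nat.card_coe_set_eq, Set.ncard_coe_finset, Finset.card_image_of_injOn hinj]
  rw [degLT, h1, h2, Finset.card_sigma]
  simp only [Finset.card_range]
  have h3 := Finset.sum_range_id_mul_two (n + 1)
  rw [Finset.sum_range_succ', add_zero, Nat.add_sub_cancel] at h3
  rw [mul_comm, h3, mul_comm]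

instance finite_degLT (n : ℕ) : Module.Finite ℂ (degLT n) := by
  have : Finite {s : Fin 2 →₀ ℕ | s.degree < n} := Finsupp.finite_of_degree_lt n
  exact Module.Finite.of_basis (basisRestrictSupport ℂ {s : Fin 2 →₀ ℕ | s.degree < n})

end Aff

end PlaneCurve

/-! ### Bézout's theorem in the affine plane -/

namespace PlaneCurve

namespace Aff

open MvPolynomial

/-- The pairs `(a, b)` with `deg a < A`, `deg b < B`, mapped to `a f + b g`. -/
noncomputable def combination (f g : Aff) (A B : ℕ) : degLT A × degLT B →ₗ[ℂ] Aff :=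
  ((LinearMap.mulRight ℂ f).comp (degLT A).subtype).coprod
    ((LinearMap.mulRight ℂ g).comp (degLT B).subtype)

theorem combination_apply (f g : Aff) (A B : ℕ) (x : degLT A × degLT B) :
    combination f g A B x = x.1 * f + x.2 * g := by
  simp [combination]

section

variable {m k : ℕ} {f f' g g' : Aff}

/-- The syzygies of `f, g` in bounded degree are the multiples of the obvious one. -/
theorem finrank_ker_combination (hf : IsTop m f f') (hg : IsTop k g g') (hg0 : g' ≠ 0)
    (hrel : IsRelPrime g' f') (e : ℕ) :
    Module.finrank ℂ (LinearMap.ker (combination f g (k + e) (m + e))) =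
      Module.finrank ℂ (degLT e) := by
  have hg1 : g ≠ 0 := by
    rintro rfl
    refine hg0 (eq_zero_of_isHomogeneous_of_mem hg.homogeneous ?_)
    simpa using neg_mem hg.sub_mem
  have hfe : ∀ c ∈ degLT e, -(c * f) ∈ degLT (m + e) := fun c hc => by
    rw [mul_comm]
    exact neg_mem (mul_mem_degLT hf.mem hc)
  have hge : ∀ c ∈ degLT e, c * g ∈ degLT (k + e) := fun c hc => by
    rw [mul_comm]
    exact mul_mem_degLT hg.mem hc
  let s : degLT e →ₗ[ℂ] degLT (k + e) × degLT (m + e) :=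
    (((LinearMap.mulRight ℂ g).comp (degLT e).subtype).codRestrict _ fun c => hge c c.2).prod
      ((-(LinearMap.mulRight ℂ f).comp (degLT e).subtype).codRestrict _ fun c => hfe c c.2)
  have hs1 : ∀ c, ((s c).1 : Aff) = c * g := fun c => rfl
  have hs2 : ∀ c, ((s c).2 : Aff) = -(c * f) := fun c => rfl
  have hinj : Function.Injective s := by
    intro c d hcd
    have := congrArg (fun x => (x.1 : Aff)) hcd
    simp only [hs1] at this
    exact Subtype.ext (mul_right_cancel₀ hg1 this)
  have hker : LinearMap.ker (combination f g (k + e) (m + e)) = LinearMap.range s := by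
    ext ⟨a, b⟩
    rw [LinearMap.mem_ker, combination_apply, LinearMap.mem_range]
    constructor
    · intro h
      obtain ⟨c, hc, hac⟩ := exists_sub_mul_mem (N := 0) hf hg hg0 hrel (k + e) a b a.2
        (by rw [h]; exact zero_mem _)
      rw [Nat.add_sub_cancel_left] at hc
      have h1 : (a : Aff) = c * g := sub_eq_zero.1 (eq_zero_of_mem_degLT_zero hac)
      refine ⟨⟨c, hc⟩, Prod.ext (Subtype.ext ?_) (Subtype.ext ?_)⟩
      · rw [hs1, h1]
      · rw [hs2]
        refine mul_right_cancel₀ hg1 ?_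
        simp only at h
        rw [h1] at h
        linear_combination -h
    · rintro ⟨c, hc⟩
      rw [← hc, hs1, hs2]
      ring
  rw [hker]
  exact LinearMap.finrank_range_of_inj hinj

theorem range_combination (hf : IsTop m f f') (hg : IsTop k g g') (hg0 : g' ≠ 0)
    (hrel : IsRelPrime g' f') (e : ℕ) :
    LinearMap.range (combination f g (k + e) (m + e)) =
      (Ideal.span {f, g}).restrictScalars ℂ ⊓ degLT (m + k + e) := by
  ext h
  rw [LinearMap.mem_range, Submodule.mem_inf, Submodule.restrictScalars_mem]
  constructor
  · rintro ⟨⟨a, b⟩, rfl⟩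
    rw [combination_apply]
    refine ⟨Ideal.mem_span_pair.2 ⟨a, b, rfl⟩, add_mem ?_ ?_⟩
    · rw [mul_comm, add_assoc]
      exact mul_mem_degLT hf.mem a.2
    · rw [mul_comm, add_comm m, add_assoc]
      exact mul_mem_degLT hg.mem b.2
  · rintro ⟨h1, h2⟩
    obtain ⟨a, b, rfl⟩ := Ideal.mem_span_pair.1 h1
    obtain ⟨r, hr⟩ := exists_mem_degLT a
    have e1 : m + k + e = k + e + m := by omega
    have e2 : m + k + e = m + e + k := by omega
    obtain ⟨c, -, hac⟩ := exists_sub_mul_mem hf hg hg0 hrel r a b hr (e1 ▸ h2)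
    have hb : b + c * f ∈ degLT (m + e) := by
      refine mem_degLT_of_mul_mem hg hg0 ?_
      have h3 : (b + c * f) * g = (a * f + b * g) - f * (a - c * g) := by ring
      rw [h3, ← e2]
      refine sub_mem h2 ?_
      rw [add_assoc]
      exact mul_mem_degLT hf.mem hac
    refine ⟨(⟨_, hac⟩, ⟨_, hb⟩), ?_⟩
    rw [combination_apply]
    ring

/-- The image of `degLT n` in the quotient by `(f, g)`. -/
noncomputable def filtration (f g : Aff) (n : ℕ) : Submodule ℂ (Aff ⧸ Ideal.span {f, g}) :=
  (degLT n).map (Ideal.Quotient.mkₐ ℂ (Ideal.span {f, g})).toLinearMap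

theorem filtration_mono {a b : ℕ} (h : a ≤ b) : filtration f g a ≤ filtration f g b :=
  Submodule.map_mono (degLT_mono h)

instance (n : ℕ) : Module.Finite ℂ (filtration f g n) := by
  unfold filtration
  infer_instance

/-- The dimension of the filtration steps is constant from `m + k` on, so that the filtration is
stationary. -/
theorem finrank_filtration (hf : IsTop m f f') (hg : IsTop k g g') (hg0 : g' ≠ 0)
    (hrel : IsRelPrime g' f') (e : ℕ) :
    Module.finrank ℂ (filtration f g (m + k + e)) = m * k := by
  set q := (Ideal.Quotient.mkₐ ℂ (Ideal.span {f, g})).toLinearMap with hq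
  have h1 := LinearMap.finrank_range_add_finrank_ker (combination f g (k + e) (m + e))
  rw [finrank_ker_combination hf hg hg0 hrel, range_combination hf hg hg0 hrel,
    Module.finrank_prod] at h1
  have h2 := LinearMap.finrank_range_add_finrank_ker (q.domRestrict (degLT (m + k + e)))
  have h3 : LinearMap.range (q.domRestrict (degLT (m + k + e))) = filtration f g (m + k + e) := by
    rw [LinearMap.range_domRestrict]
    rfl
  have h4 : Module.finrank ℂ (LinearMap.ker (q.domRestrict (degLT (m + k + e)))) =
      Module.finrank ℂ ((Ideal.span {f, g}).restrictScalars ℂ ⊓ degLT (m + k + e) :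
        Submodule ℂ Aff) := by
    have hk : LinearMap.ker q = (Ideal.span {f, g}).restrictScalars ℂ := by
      ext x
      rw [LinearMap.mem_ker, Submodule.restrictScalars_mem]
      exact Ideal.Quotient.eq_zero_iff_mem
    have hc : (LinearMap.ker q).comap (degLT (m + k + e)).subtype =
        (LinearMap.ker q ⊓ degLT (m + k + e)).comap (degLT (m + k + e)).subtype := by
      ext x
      simp
    rw [LinearMap.ker_domRestrict, hc, hk]
    exact (Submodule.comapSubtypeEquivOfLe inf_le_right).finrank_eq
  rw [h3, h4] at h2
  -- With `n = m + k + e`, the dimension is that of `degLT n`, minus those of `degLT (n - m)` and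
  -- `degLT (n - k)`, plus that of `degLT (n - m - k)`.
  have d1 := two_mul_finrank_degLT (m + k + e)
  have d2 := two_mul_finrank_degLT (k + e)
  have d3 := two_mul_finrank_degLT (m + e)
  have d4 := two_mul_finrank_degLT e
  nlinarith

theorem filtration_eq_top (hf : IsTop m f f') (hg : IsTop k g g') (hg0 : g' ≠ 0)
    (hrel : IsRelPrime g' f') : filtration f g (m + k) = ⊤ := by
  rw [eq_top_iff]
  rintro x -
  obtain ⟨p, rfl⟩ := Ideal.Quotient.mk_surjective x
  obtain ⟨n, hn⟩ := exists_mem_degLT p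
  have h1 : filtration f g (m + k + 0) = filtration f g (m + k + n) :=
    Submodule.eq_of_le_of_finrank_eq (filtration_mono (by omega)) (by
      rw [finrank_filtration hf hg hg0 hrel, finrank_filtration hf hg hg0 hrel])
  rw [add_zero] at h1
  rw [h1]
  exact ⟨p, degLT_mono (by omega) hn, rfl⟩

/-- Bézout's theorem in the affine plane, for two curves without common point at infinity. -/
theorem finrank_quotient_eq (hf : IsTop m f f') (hg : IsTop k g g') (hg0 : g' ≠ 0)
    (hrel : IsRelPrime g' f') :
    Module.finrank ℂ (Aff ⧸ Ideal.span {f, g}) = m * k := by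
  have h := finrank_filtration hf hg hg0 hrel 0
  rwa [add_zero, filtration_eq_top hf hg hg0 hrel, finrank_top] at h

theorem finite_quotient (hf : IsTop m f f') (hg : IsTop k g g') (hg0 : g' ≠ 0)
    (hrel : IsRelPrime g' f') : Module.Finite ℂ (Aff ⧸ Ideal.span {f, g}) := by
  have h : Module.Finite ℂ (filtration f g (m + k)) := inferInstance
  rw [filtration_eq_top hf hg hg0 hrel] at h
  exact Module.Finite.equiv Submodule.topEquiv

end

end Aff

end PlaneCurve

/-! ### Local decomposition of the intersection number -/

namespace PlaneCurve

namespace Aff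

open MvPolynomial

/-- The Taylor expansion of a polynomial at the point `q` of the affine plane. -/
noncomputable def germ (q : Fin 2 → ℂ) : Aff →ₐ[ℂ] PS :=
  aeval fun i => MvPowerSeries.C (q i) + MvPowerSeries.X i

/-- The ideal generated by the `N`-th powers of the coordinates centred at `q`. -/
noncomputable def box (q : Fin 2 → ℂ) (N : ℕ) : Ideal Aff :=
  Ideal.span {(X 0 - C (q 0)) ^ N, (X 1 - C (q 1)) ^ N}

theorem X_sub_C_pow_mem_box (q : Fin 2 → ℂ) (N : ℕ) (i : Fin 2) :
    (X i - C (q i)) ^ N ∈ box q N := by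
  fin_cases i
  · exact Ideal.subset_span (Set.mem_insert _ _)
  · exact Ideal.subset_span (Set.mem_insert_of_mem _ rfl)

theorem germ_C (q : Fin 2 → ℂ) (c : ℂ) : germ q (C c) = MvPowerSeries.C c := by
  rw [germ, aeval_C, MvPowerSeries.algebraMap_apply]
  rfl

theorem germ_X_sub_C (q : Fin 2 → ℂ) (i : Fin 2) : germ q (X i - C (q i)) = MvPowerSeries.X i := by
  rw [map_sub, germ_C, germ, aeval_X, add_sub_cancel_left]

theorem constantCoeff_germ (q : Fin 2 → ℂ) (p : Aff) :
    MvPowerSeries.constantCoeff (germ q p) = eval q p := by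
  induction p using MvPolynomial.induction_on with
  | C a => rw [germ_C]; simp
  | add p r hp hr => simp only [map_add, hp, hr]
  | mul_X p i hp =>
    rw [map_mul, map_mul, map_mul, hp, eval_X]
    congr 1
    simp [germ]

theorem isCoprime_box {q r : Fin 2 → ℂ} (h : q ≠ r) (N : ℕ) : IsCoprime (box q N) (box r N) := by
  obtain ⟨i, hi⟩ := Function.ne_iff.1 h
  have h1 : IsCoprime (X i - C (q i) : Aff) (X i - C (r i)) := by
    refine ⟨C ((r i - q i)⁻¹), -C ((r i - q i)⁻¹), ?_⟩
    have h2 : C ((r i - q i)⁻¹) * C (r i - q i) = (1 : Aff) := by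
      rw [← map_mul, inv_mul_cancel₀ (sub_ne_zero.2 hi.symm), map_one]
    rw [← h2, map_sub]
    ring
  obtain ⟨a, b, hab⟩ := h1.pow (m := N) (n := N)
  exact Ideal.isCoprime_iff_exists.2 ⟨_, Ideal.mul_mem_left _ a (X_sub_C_pow_mem_box q N i), _,
    Ideal.mul_mem_left _ b (X_sub_C_pow_mem_box r N i), hab⟩

theorem mem_span_X_pow_of_coeff {N : ℕ} {p : Aff}
    (h : ∀ s : Fin 2 →₀ ℕ, s 0 < N → s 1 < N → coeff s p = 0) :
    p ∈ Ideal.span {(X 0 : Aff) ^ N, X 1 ^ N} := by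
  have e : ({(X 0 : Aff) ^ N, X 1 ^ N} : Set Aff) = (fun s => monomial s (1 : ℂ)) ''
      {Finsupp.single 0 N, Finsupp.single 1 N} := by
    rw [Set.image_pair, X_pow_eq_monomial, X_pow_eq_monomial]
  rw [e, mem_ideal_span_monomial_image]
  intro s hs
  by_contra! hc
  simp only [Set.mem_insert_iff, Set.mem_singleton_iff, forall_eq_or_imp, forall_eq,
    Finsupp.single_le_iff, not_le] at hc
  exact mem_support_iff.1 hs (h s hc.1 hc.2)

/-- The translation `p ↦ p (x - q)`, under which curves through the origin become curves through
`q`. -/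
noncomputable def translate (q : Fin 2 → ℂ) : Aff →ₐ[ℂ] Aff := aeval fun i => X i - C (q i)

theorem germ_translate (q : Fin 2 → ℂ) (p : Aff) :
    germ q (translate q p) = (p : MvPowerSeries (Fin 2) ℂ) := by
  have h : (germ q).comp (translate q) = coeToMvPowerSeries.algHom ℂ := by
    ext i
    rw [AlgHom.comp_apply, translate, aeval_X, germ_X_sub_C]
    simp
  simpa using DFunLike.congr_fun h p

theorem exists_translate_eq (q : Fin 2 → ℂ) (p : Aff) : ∃ r, translate q r = p := by
  refine ⟨aeval (fun i => X i + C (q i)) p, ?_⟩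
  rw [← AlgHom.comp_apply, comp_aeval]
  have : (fun i => translate q (X i + C (q i))) = X := by
    funext i
    have hC : translate q (C (q i)) = C (q i) := (translate q).commutes _
    rw [map_add, hC, translate, aeval_X, sub_add_cancel]
  rw [this, aeval_X_left, AlgHom.id_apply]

theorem translate_mem_box {q : Fin 2 → ℂ} {N : ℕ} {p : Aff}
    (h : p ∈ Ideal.span {(X 0 : Aff) ^ N, X 1 ^ N}) : translate q p ∈ box q N := by
  obtain ⟨u, v, rfl⟩ := Ideal.mem_span_pair.1 h
  have hX : ∀ i, translate q (X i) = X i - C (q i) := fun i => aeval_X _ i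
  rw [map_add, map_mul, map_mul, map_pow, map_pow, hX, hX]
  exact Ideal.mem_span_pair.2 ⟨_, _, rfl⟩

theorem mem_box_of_germ_mem {q : Fin 2 → ℂ} {N : ℕ} {p : Aff}
    (h : germ q p ∈ Ideal.span {(MvPowerSeries.X 0 : PS) ^ N, MvPowerSeries.X 1 ^ N}) :
    p ∈ box q N := by
  obtain ⟨r, rfl⟩ := exists_translate_eq q p
  rw [germ_translate, PS.mem_span_X_pow_iff] at h
  refine translate_mem_box (mem_span_X_pow_of_coeff fun s h0 h1 => ?_)
  rw [← coeff_coe]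
  exact h s h0 h1

/-- Polynomials approximate power series to any order. -/
theorem exists_sub_germ_mem (q : Fin 2 → ℂ) (N : ℕ) (P : PS) : ∃ p : Aff,
    P - germ q p ∈ Ideal.span {(MvPowerSeries.X 0 : PS) ^ N, MvPowerSeries.X 1 ^ N} := by
  classical
  let n : Fin 2 →₀ ℕ := Finsupp.single 0 N + Finsupp.single 1 N
  refine ⟨translate q (MvPowerSeries.trunc' ℂ n P), ?_⟩
  rw [germ_translate, PS.mem_span_X_pow_iff]
  intro s h0 h1
  have hs : s ≤ n := by
    intro i
    fin_cases i
    · simpa [n] using h0.le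
    · simpa [n] using h1.le
  rw [map_sub, coeff_coe, MvPowerSeries.coeff_trunc', if_pos hs, sub_self]

theorem prod_sup_le {R σ : Type*} [CommRing R] (J : Ideal R) (I : σ → Ideal R)
    (s : Finset σ) : ∏ p ∈ s, (J ⊔ I p) ≤ J ⊔ ∏ p ∈ s, I p := by
  classical
  induction s using Finset.induction_on with
  | empty => simp
  | insert a s ha ih =>
    rw [Finset.prod_insert ha, Finset.prod_insert ha]
    refine (Ideal.mul_mono_right ih).trans ?_
    rw [Ideal.mul_le]
    intro x hx y hy
    obtain ⟨j, hj, i, hi, rfl⟩ := Submodule.mem_sup.1 hx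
    obtain ⟨j', hj', k, hk, rfl⟩ := Submodule.mem_sup.1 hy
    have e : (j + i) * (j' + k) = (j * (j' + k) + i * j') + i * k := by ring
    rw [e]
    exact Submodule.add_mem_sup
      (add_mem (Ideal.mul_mem_right _ _ hj) (Ideal.mul_mem_left _ _ hj')) (Ideal.mul_mem_mul hi hk)

/-- An ideal containing a product of pairwise coprime ideals can be tested modulo each of them. -/
theorem mem_of_forall_mem_sup {R σ : Type*} [CommRing R] [Fintype σ] {J : Ideal R}
    {I : σ → Ideal R} (hI : ∀ p p', p ≠ p' → IsCoprime (I p) (I p')) (hJ : ∏ p, I p ≤ J) {h : R}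
    (hh : ∀ p, h ∈ J ⊔ I p) : h ∈ J := by
  have h2 : h ∈ ∏ p, (J ⊔ I p) := by
    rw [Ideal.prod_eq_iInf_of_pairwise_isCoprime]
    · simpa using hh
    · intro p _ p' _ hne
      rw [Function.onFun, Ideal.isCoprime_iff_sup_eq, eq_top_iff,
        ← Ideal.isCoprime_iff_sup_eq.1 (hI p p' hne)]
      exact sup_le_sup le_sup_right le_sup_right
  exact (prod_sup_le J I Finset.univ).trans (sup_le le_rfl hJ) h2

section

variable {σ : Type*} [Fintype σ] {q : σ → Fin 2 → ℂ} {f g : Aff}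

/-- By the Nullstellensatz, `(f, g)` contains a product of powers of the maximal ideals of the
common zeros of `f` and `g`. -/
theorem exists_prod_box_le (hV : ∀ x, eval x f = 0 → eval x g = 0 → ∃ p, q p = x) :
    ∃ N ≠ 0, ∏ p, box (q p) N ≤ Ideal.span {f, g} := by
  have h1 : ∏ p, box (q p) 1 ≤ (Ideal.span {f, g}).radical := by
    rw [← vanishingIdeal_zeroLocus_eq_radical (K := ℂ)]
    intro h hh x hx
    have hf := hx f (Ideal.subset_span (Set.mem_insert _ _))
    have hg := hx g (Ideal.subset_span (Set.mem_insert_of_mem _ rfl))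
    obtain ⟨p, rfl⟩ := hV x (by simpa [aeval_eq_eval] using hf) (by simpa [aeval_eq_eval] using hg)
    have h2 : h ∈ box (q p) 1 :=
      (Ideal.prod_le_inf.trans (Finset.inf_le (Finset.mem_univ p))) hh
    obtain ⟨u, v, rfl⟩ := Ideal.mem_span_pair.1 h2
    simp [aeval_eq_eval]
  obtain ⟨N, hN⟩ := Ideal.exists_pow_le_of_le_radical_of_fg h1 (IsNoetherian.noetherian _)
  refine ⟨N + 1, N.succ_ne_zero, le_trans ?_ ((Ideal.pow_le_pow_right N.le_succ).trans hN)⟩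
  rw [← Finset.prod_pow]
  refine Finset.prod_le_prod' fun p _ => Ideal.span_le.2 ?_
  have := fun i => Ideal.pow_mem_pow (X_sub_C_pow_mem_box (q p) 1 i) (N + 1)
  simp only [pow_one] at this
  rintro _ (rfl | rfl)
  · exact this 0
  · exact this 1

/-- The dimension of `ℂ[x, y] / (f, g)` is the sum of the local intersection numbers. -/
theorem finrank_quotient_eq_sum [Module.Finite ℂ (Aff ⧸ Ideal.span {f, g})]
    (hq : Function.Injective q)
    (hV : ∀ x, eval x f = 0 → eval x g = 0 → ∃ p, q p = x) :
    Module.finrank ℂ (Aff ⧸ Ideal.span {f, g}) =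
      ∑ p, PS.inter (germ (q p) f) (germ (q p) g) := by
  classical
  obtain ⟨N, hN, hbox⟩ := exists_prod_box_le hV
  set J : Ideal Aff := Ideal.span {f, g} with hJ
  let J' : σ → Ideal PS := fun p => Ideal.span {germ (q p) f, germ (q p) g}
  have hJJ' : ∀ p, ∀ h ∈ J, germ (q p) h ∈ J' p := by
    intro p h hh
    obtain ⟨u, v, rfl⟩ := Ideal.mem_span_pair.1 hh
    rw [map_add, map_mul, map_mul]
    exact Ideal.mem_span_pair.2 ⟨_, _, rfl⟩
  have hcop : ∀ p p', p ≠ p' → IsCoprime (box (q p) N) (box (q p') N) := fun p p' h =>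
    isCoprime_box (hq.ne h) N
  -- At the point `q p` the other factors of the product of boxes become units.
  have hboxJ' : ∀ p, ∀ h ∈ box (q p) N, germ (q p) h ∈ J' p := by
    intro p h hh
    have hc : IsCoprime (box (q p) N) (∏ p' ∈ Finset.univ.erase p, box (q p') N) :=
      IsCoprime.prod_right fun p' hp' => hcop p p' (Finset.ne_of_mem_erase hp').symm
    obtain ⟨v, hv, u, hu, huv⟩ := Ideal.isCoprime_iff_exists.1 hc
    have h1 : h * u ∈ J := by
      refine hbox ?_
      rw [← Finset.mul_prod_erase _ _ (Finset.mem_univ p)]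
      exact Ideal.mul_mem_mul hh hu
    have h2 : IsUnit (germ (q p) u) := by
      rw [PS.isUnit_iff, constantCoeff_germ]
      have h3 : eval (q p) v = 0 := by
        obtain ⟨a, b, rfl⟩ := Ideal.mem_span_pair.1 hv
        simp [hN]
      have h4 := congrArg (eval (q p)) huv
      rw [map_add, h3, zero_add, map_one] at h4
      rw [h4]
      exact one_ne_zero
    have h3 := hJJ' p _ h1
    rw [map_mul] at h3
    exact (Ideal.mul_unit_mem_iff_mem _ h2).1 h3
  have hQJ' : ∀ p, Ideal.span {(MvPowerSeries.X 0 : PS) ^ N, MvPowerSeries.X 1 ^ N} ≤ J' p := by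
    intro p
    have := fun i => hboxJ' p _ (X_sub_C_pow_mem_box (q p) N i)
    simp only [map_pow, germ_X_sub_C] at this
    rw [Ideal.span_le]
    rintro _ (rfl | rfl)
    · exact this 0
    · exact this 1
  let Θ : Aff →ₐ[ℂ] (∀ p, PS ⧸ J' p) :=
    AlgHom.pi fun p => (Ideal.Quotient.mkₐ ℂ (J' p)).comp (germ (q p))
  have hΘ : ∀ h p, Θ h p = Ideal.Quotient.mk (J' p) (germ (q p) h) := fun h p => rfl
  have hsurj : Function.Surjective Θ := by
    intro P
    choose P' hP' using fun p => Ideal.Quotient.mk_surjective (P p)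
    choose t ht using fun p => exists_sub_germ_mem (q p) N (P' p)
    obtain ⟨h, hh⟩ := Ideal.exists_forall_sub_mem_ideal (I := fun p => box (q p) N)
      (fun p p' hne => hcop p p' hne) t
    refine ⟨h, funext fun p => ?_⟩
    rw [hΘ, ← hP', Ideal.Quotient.eq]
    have h1 := hboxJ' p _ (hh p)
    have h2 := hQJ' p (ht p)
    rw [map_sub] at h1
    have := sub_mem h1 h2
    have e : germ (q p) h - germ (q p) (t p) - (P' p - germ (q p) (t p)) =
      germ (q p) h - P' p := by ring
    rwa [e] at this
  have hker : RingHom.ker Θ = J := by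
    refine le_antisymm (fun h hh => ?_) (fun h hh => ?_)
    · have h1 : ∀ p, h ∈ J ⊔ box (q p) N := by
        intro p
        have h2 : germ (q p) h ∈ J' p := by
          rw [← Ideal.Quotient.eq_zero_iff_mem, ← hΘ, RingHom.mem_ker.1 hh]
          rfl
        obtain ⟨A, B, hAB⟩ := Ideal.mem_span_pair.1 h2
        obtain ⟨a, ha⟩ := exists_sub_germ_mem (q p) N A
        obtain ⟨b, hb⟩ := exists_sub_germ_mem (q p) N B
        have h3 : h - (a * f + b * g) ∈ box (q p) N := by
          refine mem_box_of_germ_mem ?_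
          have e : germ (q p) (h - (a * f + b * g)) = (A - germ (q p) a) * germ (q p) f +
              (B - germ (q p) b) * germ (q p) g := by
            rw [map_sub, map_add, map_mul, map_mul, ← hAB]
            ring
          rw [e]
          exact add_mem (Ideal.mul_mem_right _ _ ha) (Ideal.mul_mem_right _ _ hb)
        rw [← add_sub_cancel (a * f + b * g) h]
        exact Submodule.add_mem_sup (Ideal.mem_span_pair.2 ⟨a, b, rfl⟩) h3
      exact mem_of_forall_mem_sup hcop hbox h1
    · rw [RingHom.mem_ker]
      funext p
      rw [hΘ]
      exact Ideal.Quotient.eq_zero_iff_mem.2 (hJJ' p h hh)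
  let e : (Aff ⧸ J) ≃ₐ[ℂ] ∀ p, PS ⧸ J' p :=
    (Ideal.quotientEquivAlgOfEq ℂ hker.symm).trans (Ideal.quotientKerAlgEquivOfSurjective hsurj)
  have hfin : ∀ p, Module.Finite ℂ (PS ⧸ J' p) := by
    intro p
    have : Module.Finite ℂ (∀ p, PS ⧸ J' p) := Module.Finite.equiv e.toLinearEquiv
    exact Module.Finite.of_surjective (LinearMap.proj (R := ℂ) (φ := fun p => PS ⧸ J' p) p)
      (LinearMap.proj_surjective p)
  rw [e.toLinearEquiv.finrank_eq, Module.finrank_pi_fintype]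
  rfl

end

end Aff

end PlaneCurve

/-! ### Bézout's theorem in the projective plane -/

namespace PlaneCurve

open MvPolynomial

theorem eval_smul_of_isHomogeneous {F : MvPolynomial (Fin 3) ℂ} {n : ℕ} (hF : F.IsHomogeneous n)
    (c : ℂ) (v : Fin 3 → ℂ) : eval (c • v) F = c ^ n * eval v F := by
  have h : c • v = fun i => c * v i := rfl
  simpa only [aeval_eq_eval, h] using aeval_mul_of_isHomogeneous hF c v

/-- At a common point of two curves, their union is singular. -/
theorem mem_singularLocus_mul {F G : MvPolynomial (Fin 3) ℂ} {p : P2} (hF : eval p.rep F = 0)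
    (hG : eval p.rep G = 0) : p ∈ singularLocus (F * G) := by
  refine ⟨?_, fun i => ?_⟩
  · change eval p.rep (F * G) = 0
    rw [map_mul, hF, zero_mul]
  · rw [Derivation.leibniz]
    simp [hF, hG]

/-- A linear form which does not vanish at a given finite set of points, with a frame adapted to
it: the last two vectors span the line at infinity. -/
theorem exists_frame_avoiding {S : Set P2} (hS : S.Finite) :
    ∃ (w : Module.Dual ℂ (Fin 3 → ℂ)) (e a b : Fin 3 → ℂ), LinearIndependent ℂ ![e, a, b] ∧
      w e = 1 ∧ w a = 0 ∧ w b = 0 ∧ ∀ p ∈ S, w p.rep ≠ 0 := by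
  have := hS.to_subtype
  let u : Option S → (Fin 3 → ℂ) := fun o => o.elim 1 fun p => (p : P2).rep
  obtain ⟨w, hw⟩ := Module.exists_dual_forall_apply_ne_zero (K := ℂ) u (by
    rintro (_ | p)
    · exact one_ne_zero
    · exact Projectivization.rep_nonzero _)
  have hw1 : w 1 ≠ 0 := hw none
  have hw0 : w ≠ 0 := fun h => hw1 (by rw [h]; rfl)
  have hk : Module.finrank ℂ (LinearMap.ker w) = 2 := by
    have := Module.Dual.finrank_ker_add_one_of_ne_zero hw0
    rw [Module.finrank_fin_fun] at this
    omega
  let β := Module.finBasisOfFinrankEq ℂ (LinearMap.ker w) hk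
  refine ⟨w, (w 1)⁻¹ • 1, β 0, β 1, ?_, ?_, (β 0).2, (β 1).2, fun p hp => hw (some ⟨p, hp⟩)⟩
  · have h1 : LinearIndependent ℂ fun i => (β i : Fin 3 → ℂ) :=
      β.linearIndependent.map' (LinearMap.ker w).subtype (Submodule.ker_subtype _)
    have h2 : (![(w 1)⁻¹ • 1, (β 0 : Fin 3 → ℂ), (β 1 : Fin 3 → ℂ)] : Fin 3 → Fin 3 → ℂ) =
        Fin.cons ((w 1)⁻¹ • 1) fun i => (β i : Fin 3 → ℂ) := by
      funext i
      fin_cases i <;> rfl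
    rw [h2, linearIndependent_finCons]
    refine ⟨h1, fun h => ?_⟩
    have h3 : Submodule.span ℂ (Set.range fun i => (β i : Fin 3 → ℂ)) ≤ LinearMap.ker w := by
      rw [Submodule.span_le]
      rintro _ ⟨i, rfl⟩
      exact (β i).2
    have h4 := LinearMap.mem_ker.1 (h3 h)
    rw [map_smul, smul_eq_mul, inv_mul_cancel₀ hw1] at h4
    exact one_ne_zero h4
  · rw [map_smul, smul_eq_mul, inv_mul_cancel₀ hw1]

/-- The point with affine coordinates `x` in the chart given by a projective frame. -/
def affinePoint (e a b : Fin 3 → ℂ) (x : Fin 2 → ℂ) : Fin 3 → ℂ := e + x 0 • a + x 1 • b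

/-- The affine equation of the curve `F = 0` in the chart given by a projective frame. -/
noncomputable def dehomogenize (e a b : Fin 3 → ℂ) : MvPolynomial (Fin 3) ℂ →ₐ[ℂ] Aff :=
  aeval fun i => C (e i) + C (a i) * X 0 + C (b i) * X 1

theorem eval_dehomogenize (e a b : Fin 3 → ℂ) (x : Fin 2 → ℂ) (F : MvPolynomial (Fin 3) ℂ) :
    eval x (dehomogenize e a b F) = eval (affinePoint e a b x) F := by
  rw [← aeval_eq_eval, ← aeval_eq_eval]
  rw [dehomogenize, ← AlgHom.comp_apply, comp_aeval]
  congr 2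
  funext i
  simp [affinePoint]
  ring

theorem germ_dehomogenize (e a b : Fin 3 → ℂ) (x : Fin 2 → ℂ) (F : MvPolynomial (Fin 3) ℂ) :
    Aff.germ x (dehomogenize e a b F) = localEquation F (affinePoint e a b x) a b := by
  rw [localEquation_eq_aeval, dehomogenize, ← AlgHom.comp_apply, comp_aeval]
  congr 2
  funext i
  rw [map_add, map_add, map_mul, map_mul, Aff.germ_C, Aff.germ_C, Aff.germ_C, chart_apply]
  simp [Aff.germ, frame, affinePoint]
  ring

theorem isTop_dehomogenize {F : MvPolynomial (Fin 3) ℂ} {n : ℕ} (hF : F.IsHomogeneous n)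
    (e a b : Fin 3 → ℂ) :
    Aff.IsTop n (dehomogenize e a b F) (aeval (fun i => C (a i) * X 0 + C (b i) * X 1) F) := by
  refine Aff.isTop_aeval hF fun i => ⟨?_, ?_⟩
  · exact (isHomogeneous_C_mul_X _ _).add (isHomogeneous_C_mul_X _ _)
  · have : C (e i) + C (a i) * X 0 + C (b i) * X 1 - (C (a i) * X 0 + C (b i) * X 1) =
      (C (e i) : Aff) := by ring
    rw [this]
    exact Aff.mem_degLT_of_isHomogeneous (isHomogeneous_C _ _)

theorem eval_top (a b : Fin 3 → ℂ) (x : Fin 2 → ℂ) (F : MvPolynomial (Fin 3) ℂ) :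
    eval x (aeval (fun i => C (a i) * X 0 + C (b i) * X 1 : Fin 3 → Aff) F) =
      eval (x 0 • a + x 1 • b) F := by
  rw [← aeval_eq_eval, ← aeval_eq_eval]
  rw [← AlgHom.comp_apply, comp_aeval]
  congr 2
  funext i
  simp
  ring

/-- A common zero of two forms represents a point of their common zero locus. -/
theorem exists_point {F G : MvPolynomial (Fin 3) ℂ} {m n : ℕ} (hF : F.IsHomogeneous m)
    (hG : G.IsHomogeneous n) {v : Fin 3 → ℂ} (hv : v ≠ 0) (hvF : eval v F = 0)
    (hvG : eval v G = 0) :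
    ∃ (p : P2) (c : ℂ), c ≠ 0 ∧ p.rep = c • v ∧ eval p.rep F = 0 ∧ eval p.rep G = 0 := by
  obtain ⟨c, hc⟩ := Projectivization.exists_smul_eq_mk_rep ℂ v hv
  have hc' : (Projectivization.mk ℂ v hv).rep = (c : ℂ) • v := hc.symm
  refine ⟨Projectivization.mk ℂ v hv, c, c.ne_zero, hc', ?_, ?_⟩
  · rw [hc', eval_smul_of_isHomogeneous hF, hvF, mul_zero]
  · rw [hc', eval_smul_of_isHomogeneous hG, hvG, mul_zero]

theorem linearIndependent_affinePoint {e a b : Fin 3 → ℂ} (h : LinearIndependent ℂ ![e, a, b])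
    (x : Fin 2 → ℂ) : LinearIndependent ℂ ![affinePoint e a b x, a, b] := by
  rw [Fintype.linearIndependent_iff] at *
  intro c hc
  have h1 := h ![c 0, c 0 * x 0 + c 1, c 0 * x 1 + c 2] (by
    rw [← hc]
    simp only [Fin.sum_univ_three, Matrix.cons_val_zero, Matrix.cons_val_one, Matrix.cons_val,
      affinePoint]
    module)
  have h2 : c 0 = 0 := h1 0
  have h3 : c 0 * x 0 + c 1 = 0 := h1 1
  have h4 : c 0 * x 1 + c 2 = 0 := h1 2
  rw [h2, zero_mul, zero_add] at h3 h4
  intro i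
  fin_cases i
  exacts [h2, h3, h4]

section Bezout

variable {w : Module.Dual ℂ (Fin 3 → ℂ)} {e a b : Fin 3 → ℂ}

theorem apply_affinePoint (he : w e = 1) (ha : w a = 0) (hb : w b = 0) (x : Fin 2 → ℂ) :
    w (affinePoint e a b x) = 1 := by
  simp [affinePoint, he, ha, hb]

theorem affinePoint_injective (hlin : LinearIndependent ℂ ![e, a, b]) :
    Function.Injective (affinePoint e a b) := by
  intro x y hxy
  have h := Fintype.linearIndependent_iff.1 hlin ![0, x 0 - y 0, x 1 - y 1] (by
    simp only [Fin.sum_univ_three, Matrix.cons_val_zero, Matrix.cons_val_one, Matrix.cons_val]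
    rw [affinePoint, affinePoint] at hxy
    rw [sub_smul, sub_smul, zero_smul]
    linear_combination (exp := 1) hxy)
  funext i
  fin_cases i
  · exact sub_eq_zero.1 (h 1)
  · exact sub_eq_zero.1 (h 2)

/-- Every point off the line at infinity has affine coordinates. -/
theorem exists_affinePoint (hlin : LinearIndependent ℂ ![e, a, b]) (he : w e = 1) (ha : w a = 0)
    (hb : w b = 0) {v : Fin 3 → ℂ} (hv : w v ≠ 0) : ∃ x, v = w v • affinePoint e a b x := by
  let β := basisOfLinearIndependentOfCardEqFinrank hlin (by simp)
  have hβ : ⇑β = ![e, a, b] := coe_basisOfLinearIndependentOfCardEqFinrank _ _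
  have h := β.sum_repr v
  rw [hβ, Fin.sum_univ_three] at h
  simp only [Matrix.cons_val_zero, Matrix.cons_val_one, Matrix.cons_val] at h
  have h0 : w v = β.repr v 0 := by
    have h1 := congrArg w h
    simp only [map_add, map_smul, he, ha, hb, smul_eq_mul, mul_one, mul_zero, add_zero] at h1
    exact h1.symm
  refine ⟨![(w v)⁻¹ * β.repr v 1, (w v)⁻¹ * β.repr v 2], ?_⟩
  simp only [affinePoint, Matrix.cons_val_zero, Matrix.cons_val_one, smul_add, smul_smul]
  rw [mul_inv_cancel_left₀ hv, mul_inv_cancel_left₀ hv]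
  nth_rw 1 [← h]
  rw [h0]

/-- Bézout's theorem for two plane curves which meet only in points of the finite set `S`, none of
which lies on the line at infinity. -/
theorem sum_inter_eq_mul (hlin : LinearIndependent ℂ ![e, a, b]) (he : w e = 1)
    (ha : w a = 0) (hb : w b = 0) {S : Finset P2} (hS : ∀ p ∈ S, w p.rep ≠ 0) {x : P2 → Fin 2 → ℂ}
    (hx : ∀ p ∈ S, p.rep = w p.rep • affinePoint e a b (x p))
    {F G : MvPolynomial (Fin 3) ℂ} {m n : ℕ} (hF : F.IsHomogeneous m)
    (hG : G.IsHomogeneous n) (hm : 1 ≤ m)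
    (hFG : ∀ p : P2, eval p.rep F = 0 → eval p.rep G = 0 → p ∈ S) :
    ∑ p ∈ S, PS.inter (localEquation F (affinePoint e a b (x p)) a b)
      (localEquation G (affinePoint e a b (x p)) a b) = m * n := by
  have hf := isTop_dehomogenize hF e a b
  have hg := isTop_dehomogenize hG e a b
  set f' : Aff := aeval (fun i => C (a i) * X 0 + C (b i) * X 1) F
  set g' : Aff := aeval (fun i => C (a i) * X 0 + C (b i) * X 1) G
  have hrel : IsRelPrime g' f' := by
    refine Aff.isRelPrime_of_forall_eval fun y hyG hyF => ?_
    rw [eval_top] at hyF hyG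
    by_contra hy
    have hv : y 0 • a + y 1 • b ≠ 0 := by
      intro h0
      have h := Fintype.linearIndependent_iff.1 hlin ![0, y 0, y 1] (by
        simpa [Fin.sum_univ_three] using h0)
      refine hy (funext fun i => ?_)
      fin_cases i
      · exact h 1
      · exact h 2
    obtain ⟨p, c, -, hp, hpF, hpG⟩ := exists_point hF hG hv hyF hyG
    refine hS p (hFG p hpF hpG) ?_
    rw [hp]
    simp [ha, hb]
  have hg0 : g' ≠ 0 := by
    intro h0
    have h1 : IsUnit f' := hrel (by rw [h0]; exact dvd_zero _) dvd_rfl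
    have h2 : eval 0 f' = 0 := by
      have h3 : eval ((0 : ℂ) • (0 : Fin 3 → ℂ)) F = 0 := by
        rw [eval_smul_of_isHomogeneous hF, zero_pow (by omega), zero_mul]
      rw [eval_top]
      simpa using h3
    exact (h1.map (eval (0 : Fin 2 → ℂ))).ne_zero h2
  have := Aff.finite_quotient hf hg hg0 hrel
  rw [← Aff.finrank_quotient_eq hf hg hg0 hrel,
    Aff.finrank_quotient_eq_sum (q := fun p : S => x p), ← Finset.sum_coe_sort S]
  · simp only [germ_dehomogenize]
  · intro p p' hpp
    have h1 := hx p p.2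
    have h2 := hx p' p'.2
    simp only at hpp
    rw [← hpp] at h2
    refine Subtype.ext ?_
    rw [← Projectivization.mk_rep (p : P2), ← Projectivization.mk_rep (p' : P2),
      Projectivization.mk_eq_mk_iff']
    refine ⟨w (p : P2).rep * (w (p' : P2).rep)⁻¹, ?_⟩
    rw [mul_smul]
    conv_lhs => rw [h2]
    conv_rhs => rw [h1]
    congr 1
    have h3 : w (affinePoint e a b (x p)) = 1 := apply_affinePoint he ha hb _
    rw [map_smul, h3, smul_eq_mul, mul_one, inv_smul_smul₀ (hS p' p'.2)]
  · intro y hyF hyG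
    rw [eval_dehomogenize] at hyF hyG
    have hw1 := apply_affinePoint he ha hb y
    obtain ⟨p, c, hc, hp, hpF, hpG⟩ := exists_point hF hG
      (fun h0 => by rw [h0, map_zero] at hw1; exact zero_ne_one hw1) hyF hyG
    have hpS := hFG p hpF hpG
    refine ⟨⟨p, hpS⟩, affinePoint_injective hlin ?_⟩
    have h1 := hx p hpS
    have h2 : w p.rep = c := by rw [hp, map_smul, hw1, smul_eq_mul, mul_one]
    rw [h2, hp] at h1
    exact (smul_right_injective _ hc h1).symm

end Bezout

end PlaneCurve

/-! ### Singular points of unions of smooth curves -/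

namespace PlaneCurve

theorem PS.totalInter_congr {ι : Type*} [Fintype ι] [DecidableEq ι] {f g : ι → PS}
    (h : ∀ i, Associated (f i) (g i)) : totalInter f = totalInter g :=
  Finset.sum_congr rfl fun i _ =>
    inter_of_associated (h i) (Associated.prod _ _ _ fun j _ => h j)

theorem PS.totalInter_map {ι : Type*} [Fintype ι] [DecidableEq ι] (φ : PS ≃ₐ[ℂ] PS)
    (f : ι → PS) : totalInter (fun i => φ (f i)) = totalInter f := by
  refine Finset.sum_congr rfl fun i _ => ?_
  rw [← map_prod, inter_map]

/-- A point with a reducible germ is a singular point. -/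
theorem HasGerm.mem_singularLocus {F : MvPolynomial (Fin 3) ℂ} {n : ℕ} (hF : F.IsHomogeneous n)
    {p : P2} {g₁ g₂ : PS} (h : HasGerm F p (g₁ * g₂)) (h₁ : ¬IsUnit g₁) (h₂ : ¬IsUnit g₂) :
    p ∈ singularLocus F := by
  obtain ⟨a, b, hlin, φ, hφ⟩ := h
  have h0 : MvPolynomial.eval p.rep F = 0 := by
    by_contra hc
    have hu : IsUnit (localEquation F p.rep a b) := by
      rwa [PS.isUnit_iff, constantCoeff_localEquation]
    exact h₁ (isUnit_of_mul_isUnit_left (hφ.isUnit (hu.map φ)))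
  refine ⟨h0, ?_⟩
  by_contra! hc
  have hirr := irreducible_localEquation hF hlin h0 hc
  have h3 : Irreducible (g₁ * g₂) := hφ.irreducible ((MulEquiv.irreducible_iff φ).2 hirr)
  exact (h3.isUnit_or_isUnit rfl).elim h₁ h₂

/-- At a point where the germ of a union of smooth curves is a product of primes, the number of
curves through the point and their total intersection number can be read off from the germ. -/
theorem HasGerm.ncard_and_totalInter {ι κ : Type*} [Fintype ι] [DecidableEq ι] [Fintype κ]
    [DecidableEq κ] {F : ι → MvPolynomial (Fin 3) ℂ} {n : ι → ℕ}
    (hF : ∀ i, IsSmoothEquation (F i) (n i)) {p : P2} {v a b : Fin 3 → ℂ}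
    (hlin : LinearIndependent ℂ ![v, a, b]) {c : ℂ} (hc : c ≠ 0) (hp : p.rep = c • v)
    {q : κ → PS} (hq : ∀ j, Prime (q j)) (h : HasGerm (∏ i, F i) p (∏ j, q j)) :
    {i | p ∈ zeroLocus (F i)}.ncard = Fintype.card κ ∧
      PS.totalInter (fun i => localEquation (F i) v a b) = PS.totalInter q := by
  obtain ⟨a', b', hlin', φ, hφ⟩ := h
  have hunit : ∀ i, IsUnit (φ (localEquation (F i) p.rep a' b')) ↔ p ∉ zeroLocus (F i) := by
    intro i
    rw [MulEquiv.isUnit_map φ, PS.isUnit_iff, constantCoeff_localEquation]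
    rfl
  have key := PS.card_and_totalInter_eq (fun i => φ (localEquation (F i) p.rep a' b')) q
    (fun i hi => by
      have h0 : p ∈ zeroLocus (F i) := not_not.1 (mt (hunit i).2 hi)
      refine (MulEquiv.irreducible_iff φ).2
        (irreducible_localEquation (hF i).homogeneous hlin' h0 ?_)
      by_contra! hs
      have hmem : p ∈ singularLocus (F i) := ⟨h0, hs⟩
      rw [(hF i).smooth] at hmem
      exact hmem) hq (by rwa [← map_prod, ← localEquation_prod])
  obtain ⟨θ, hθ⟩ := exists_algEquiv_localEquation hlin hlin' hc hp
  refine ⟨?_, ?_⟩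
  · rw [← key.1]
    congr 1
    ext i
    exact not_iff_not.1 (by simpa using (hunit i).symm)
  · rw [← key.2, PS.totalInter_map, ← PS.totalInter_map θ]
    exact (PS.totalInter_congr fun i => hθ (F i) (n i) (hF i).homogeneous).symm

/-- Summing Bézout's theorem over the curves of a family of smooth curves with finitely many
singular points: the number `∑ nᵢ (N - nᵢ)`, with `N = ∑ nᵢ`, is distributed over the singular
points. -/
theorem exists_sum_totalInter {ι : Type*} [Fintype ι] [DecidableEq ι]
    {F : ι → MvPolynomial (Fin 3) ℂ} {n : ι → ℕ} (hF : ∀ i, IsSmoothEquation (F i) (n i))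
    (hn : ∀ i, 1 ≤ n i) {S : Finset P2} (hS : singularLocus (∏ i, F i) ⊆ S) :
    ∃ (a b : Fin 3 → ℂ) (v : P2 → Fin 3 → ℂ),
      (∀ p ∈ S, LinearIndependent ℂ ![v p, a, b] ∧ ∃ c : ℂ, c ≠ 0 ∧ p.rep = c • v p) ∧
      ∑ p ∈ S, PS.totalInter (fun i => localEquation (F i) (v p) a b) =
        ∑ i, n i * ∑ j ∈ Finset.univ.erase i, n j := by
  obtain ⟨w, e, a, b, hlin, he, ha, hb, hw⟩ := exists_frame_avoiding S.finite_toSet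
  have hx' : ∀ p : P2, ∃ x, p ∈ S → p.rep = w p.rep • affinePoint e a b x := by
    intro p
    by_cases hp : p ∈ S
    · obtain ⟨x, hx⟩ := exists_affinePoint hlin he ha hb (hw p hp)
      exact ⟨x, fun _ => hx⟩
    · exact ⟨0, fun h => absurd h hp⟩
  choose x hx using hx'
  refine ⟨a, b, fun p => affinePoint e a b (x p), fun p hp =>
    ⟨linearIndependent_affinePoint hlin _, _, hw p hp, hx p hp⟩, ?_⟩
  simp only [PS.totalInter]
  rw [Finset.sum_comm]
  refine Finset.sum_congr rfl fun i _ => ?_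
  simp only [← localEquation_prod]
  refine sum_inter_eq_mul hlin he ha hb (fun p hp => hw p hp) (fun p hp => hx p hp)
    (hF i).homogeneous
    (MvPolynomial.IsHomogeneous.prod _ _ _ fun j _ => (hF j).homogeneous) (hn i)
    fun p hpF hpG => hS ?_
  rw [← Finset.mul_prod_erase _ _ (Finset.mem_univ i)]
  exact mem_singularLocus_mul hpF hpG

theorem sum_eq_sum_mul_ncard {α τ : Type*} [Fintype τ] (S : Finset α) (c : α → ℕ) (T : τ → Set α)
    (val : τ → ℕ) (hsub : ∀ t, T t ⊆ S) (hval : ∀ t, ∀ p ∈ T t, c p = val t)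
    (hex : ∀ p ∈ S, ∃ t, p ∈ T t) (huniq : ∀ p t t', p ∈ T t → p ∈ T t' → t = t') :
    ∑ p ∈ S, c p = ∑ t, val t * (T t).ncard := by
  classical
  have h1 : ∀ p ∈ S, c p = ∑ t, if p ∈ T t then val t else 0 := by
    intro p hp
    obtain ⟨t, ht⟩ := hex p hp
    rw [Finset.sum_eq_single t (fun t' _ hne => if_neg fun ht' => hne (huniq p t' t ht' ht))
      (fun h => absurd (Finset.mem_univ t) h), if_pos ht, hval t p ht]
  rw [Finset.sum_congr rfl h1, Finset.sum_comm]
  refine Finset.sum_congr rfl fun t _ => ?_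
  have h2 : T t = ↑(S.filter fun p => p ∈ T t) := by
    ext p
    simp only [Finset.coe_filter, Set.mem_ofPred_eq]
    exact ⟨fun h => ⟨hsub t h, h⟩, fun h => h.2⟩
  rw [← Finset.sum_filter, Finset.sum_const, smul_eq_mul, mul_comm]
  conv_rhs => rw [h2, Set.ncard_coe_finset]

/-- The invariants of the seven types of singularities that occur: the number of branches and the
sum of the intersection numbers over ordered pairs of branches. -/
def typeInvariants : Fin 7 → ℕ × ℕ :=
  ![(2, 2), (2, 4), (3, 6), (2, 6), (2, 8), (2, 12), (3, 16)]

/-- The points of the seven types `A₁, A₃, D₄, A₅, A₇, A₁₁, D₁₄`. -/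
def typePoints (F : MvPolynomial (Fin 3) ℂ) : Fin 7 → Set P2 :=
  ![pointsA F 1, pointsA F 3, pointsD F 4, pointsA F 5, pointsA F 7, pointsA F 11, pointsD F 14]

/-- The germs of the seven types are products of primes with the stated invariants. -/
theorem exists_branches (t : Fin 7) : ∃ (r : ℕ) (q : Fin r → PS), 2 ≤ r ∧ (∀ j, Prime (q j)) ∧
    (r, PS.totalInter q) = typeInvariants t ∧
    ∀ F, typePoints F t = {p | HasGerm F p (∏ j, q j)} := by
  have hA : ∀ (t : Fin 7) (m r : ℕ), r ≠ 0 → m + 1 = 2 * r → typeInvariants t = (2, 2 * r) →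
      (∀ F, typePoints F t = pointsA F m) → ∃ (r : ℕ) (q : Fin r → PS), 2 ≤ r ∧
      (∀ j, Prime (q j)) ∧ (r, PS.totalInter q) = typeInvariants t ∧
      ∀ F, typePoints F t = {p | HasGerm F p (∏ j, q j)} := by
    intro t m r hr hm ht hF
    exact ⟨2, PS.branchesA r, le_rfl, PS.branchesA_prime hr,
      by rw [PS.totalInter_branchesA hr, ht], fun F => by rw [PS.prod_branchesA hm, hF]; rfl⟩
  have hD : ∀ (t : Fin 7) (m r : ℕ), r ≠ 0 → m = 2 * r + 2 → typeInvariants t = (3, 2 * r + 4) →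
      (∀ F, typePoints F t = pointsD F m) → ∃ (r : ℕ) (q : Fin r → PS), 2 ≤ r ∧
      (∀ j, Prime (q j)) ∧ (r, PS.totalInter q) = typeInvariants t ∧
      ∀ F, typePoints F t = {p | HasGerm F p (∏ j, q j)} := by
    intro t m r hr hm ht hF
    exact ⟨3, PS.branchesD r, by norm_num, PS.branchesD_prime hr,
      by rw [PS.totalInter_branchesD hr, ht], fun F => by rw [PS.prod_branchesD hm, hF]; rfl⟩
  fin_cases t
  · exact hA 0 1 1 one_ne_zero rfl rfl fun _ => rfl
  · exact hA 1 3 2 two_ne_zero rfl rfl fun _ => rfl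
  · exact hD 2 4 1 one_ne_zero rfl rfl fun _ => rfl
  · exact hA 3 5 3 three_ne_zero rfl rfl fun _ => rfl
  · exact hA 4 7 4 four_ne_zero rfl rfl fun _ => rfl
  · exact hA 5 11 6 (by norm_num) rfl rfl fun _ => rfl
  · exact hD 6 14 6 (by norm_num) rfl rfl fun _ => rfl

/-- The count for a finite family of smooth plane curves of any degrees: if their union has
only singularities of the seven types, both sides count the intersections of each curve with the
union of the others. -/
theorem sum_degrees_eq_sum_types {ι : Type*} [Fintype ι] [DecidableEq ι]
    {F : ι → MvPolynomial (Fin 3) ℂ} {n : ι → ℕ} (hF : ∀ i, IsSmoothEquation (F i) (n i))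
    (hn : ∀ i, 1 ≤ n i)
    (hsing : ∀ p ∈ singularLocus (∏ i, F i), ∃ t, p ∈ typePoints (∏ i, F i) t)
    (hfin : ∀ t, (typePoints (∏ i, F i) t).Finite) :
    ∑ i, n i * ∑ j ∈ Finset.univ.erase i, n j =
      ∑ t, (typeInvariants t).2 * (typePoints (∏ i, F i) t).ncard := by
  have hSfin : (singularLocus (∏ i, F i)).Finite :=
    (Set.finite_iUnion hfin).subset fun p hp => Set.mem_iUnion.2 (hsing p hp)
  have hS : ∀ p, p ∈ hSfin.toFinset ↔ p ∈ singularLocus (∏ i, F i) := fun p => by simp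
  obtain ⟨a, b, v, hv, hsum⟩ := exists_sum_totalInter hF hn (S := hSfin.toFinset)
    (fun p hp => (hS p).2 hp)
  have hhom : (∏ i, F i).IsHomogeneous (∑ i, n i) :=
    MvPolynomial.IsHomogeneous.prod _ _ _ fun i _ => (hF i).homogeneous
  have hsub : ∀ t, ∀ p ∈ typePoints (∏ i, F i) t, p ∈ singularLocus (∏ i, F i) := by
    intro t p hp
    obtain ⟨r, q, hr, hq, -, hgerm⟩ := exists_branches t
    rw [hgerm] at hp
    obtain ⟨s, rfl⟩ := Nat.exists_eq_add_of_le hr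
    have hp' : HasGerm (∏ i, F i) p (∏ j, q j) := hp
    let i₀ : Fin (2 + s) := ⟨0, by omega⟩
    let i₁ : Fin (2 + s) := ⟨1, by omega⟩
    rw [← Finset.mul_prod_erase _ _ (Finset.mem_univ i₀)] at hp'
    refine hp'.mem_singularLocus hhom (hq i₀).not_isUnit fun hu => ?_
    rw [IsUnit.prod_iff] at hu
    exact (hq i₁).not_isUnit (hu i₁ (by simp [i₀, i₁]))
  have hinv : ∀ t, ∀ p ∈ typePoints (∏ i, F i) t, ({i | p ∈ zeroLocus (F i)}.ncard,
      PS.totalInter fun i => localEquation (F i) (v p) a b) = typeInvariants t := by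
    intro t p hp
    obtain ⟨hlin, c, hc, hrep⟩ := hv p ((hS p).2 (hsub t p hp))
    obtain ⟨r, q, -, hq, ht, hgerm⟩ := exists_branches t
    rw [hgerm] at hp
    obtain ⟨h1, h2⟩ := HasGerm.ncard_and_totalInter hF hlin hc hrep hq hp
    rw [← ht, h1, h2, Fintype.card_fin]
  have hinj : Function.Injective typeInvariants := by decide
  rw [← hsum]
  exact sum_eq_sum_mul_ncard _ _ _ _ (fun t p hp => (hS p).2 (hsub t p hp))
    (fun t p hp => by rw [← hinv t p hp])
    (fun p hp => hsing p ((hS p).1 hp))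
    fun p t t' ht ht' => hinj (by rw [← hinv t p ht, hinv t' p ht'])

end PlaneCurve

theorem proposition4p1 (d k l : ℕ) (hd : 1 ≤ d) (hk : 1 ≤ k) (hl : 1 ≤ l)
    (𝒞 : PlaneCurve.Arrangement d k l)
    (hsing : ∀ p ∈ PlaneCurve.singularLocus 𝒞.equation,
      p ∈ PlaneCurve.pointsA 𝒞.equation 1 ∨ p ∈ PlaneCurve.pointsA 𝒞.equation 3 ∨
      p ∈ PlaneCurve.pointsD 𝒞.equation 4 ∨ p ∈ PlaneCurve.pointsA 𝒞.equation 5 ∨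
      p ∈ PlaneCurve.pointsA 𝒞.equation 7 ∨ p ∈ PlaneCurve.pointsA 𝒞.equation 11 ∨
      p ∈ PlaneCurve.pointsD 𝒞.equation 14)
    (n₂ t₃ n₃ t₅ t₇ t₁₁ d₁₄ : ℕ)
    (hn₂ : (PlaneCurve.pointsA 𝒞.equation 1).encard = n₂)
    (ht₃ : (PlaneCurve.pointsA 𝒞.equation 3).encard = t₃)
    (hn₃ : (PlaneCurve.pointsD 𝒞.equation 4).encard = n₃)
    (ht₅ : (PlaneCurve.pointsA 𝒞.equation 5).encard = t₅)
    (ht₇ : (PlaneCurve.pointsA 𝒞.equation 7).encard = t₇)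
    (ht₁₁ : (PlaneCurve.pointsA 𝒞.equation 11).encard = t₁₁)
    (hd₁₄ : (PlaneCurve.pointsD 𝒞.equation 14).encard = d₁₄) :
    ((d : ℤ) + 2 * k + 3 * l) ^ 2 - d - 4 * k - 9 * l
        = (d : ℤ) * (d - 1) + 4 * (k * (k - 1)) + 9 * (l * (l - 1))
          + 4 * d * k + 6 * d * l + 12 * k * l ∧
    (d : ℤ) * (d - 1) + 4 * (k * (k - 1)) + 9 * (l * (l - 1))
          + 4 * d * k + 6 * d * l + 12 * k * l
        = 2 * n₂ + 4 * t₃ + 6 * n₃ + 6 * t₅ + 8 * t₇ + 12 * t₁₁ + 16 * d₁₄ := by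
  classical
  refine ⟨by ring, ?_⟩
  let F : Fin d ⊕ Fin k ⊕ Fin l → MvPolynomial (Fin 3) ℂ :=
    Sum.elim 𝒞.line (Sum.elim 𝒞.conic 𝒞.cubic)
  let n : Fin d ⊕ Fin k ⊕ Fin l → ℕ := Sum.elim (fun _ => 1) (Sum.elim (fun _ => 2) fun _ => 3)
  have hF : ∀ i, PlaneCurve.IsSmoothEquation (F i) (n i) := by
    rintro (i | i | i)
    exacts [𝒞.line_smooth i, 𝒞.conic_smooth i, 𝒞.cubic_smooth i]
  have hn : ∀ i, 1 ≤ n i := by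
    rintro (i | i | i) <;> simp [n]
  have hprod : ∏ i, F i = 𝒞.equation := by
    rw [Fintype.prod_sum_type, Fintype.prod_sum_type, ← mul_assoc]
    rfl
  have hcard : ∀ {s : Set PlaneCurve.P2} {m : ℕ}, s.encard = m → s.Finite ∧ s.ncard = m :=
    fun {s m} h => ⟨Set.finite_of_encard_eq_coe h, by rw [Set.ncard, h, ENat.toNat_natCast]⟩
  have key := PlaneCurve.sum_degrees_eq_sum_types hF hn (by
    rw [hprod]
    intro p hp
    rcases hsing p hp with h | h | h | h | h | h | h
    exacts [⟨0, h⟩, ⟨1, h⟩, ⟨2, h⟩, ⟨3, h⟩, ⟨4, h⟩, ⟨5, h⟩, ⟨6, h⟩]) (by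
    rw [hprod]
    intro t
    fin_cases t
    exacts [(hcard hn₂).1, (hcard ht₃).1, (hcard hn₃).1, (hcard ht₅).1, (hcard ht₇).1,
      (hcard ht₁₁).1, (hcard hd₁₄).1])
  rw [hprod] at key
  have hright : ∑ t, (PlaneCurve.typeInvariants t).2 *
      (PlaneCurve.typePoints 𝒞.equation t).ncard =
      2 * n₂ + 4 * t₃ + 6 * n₃ + 6 * t₅ + 8 * t₇ + 12 * t₁₁ + 16 * d₁₄ := by
    rw [Fin.sum_univ_seven, ← (hcard hn₂).2, ← (hcard ht₃).2, ← (hcard hn₃).2, ← (hcard ht₅).2,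
      ← (hcard ht₇).2, ← (hcard ht₁₁).2, ← (hcard hd₁₄).2]
    rfl
  have hN : ∑ i, n i = d + 2 * k + 3 * l := by
    simp [n, Fintype.sum_sum_type]
    ring
  have hsq : ∑ i, n i * n i = d + 4 * k + 9 * l := by
    simp [n, Fintype.sum_sum_type]
    ring
  have hleft : ∑ i, n i * ∑ j ∈ Finset.univ.erase i, n j + ∑ i, n i * n i =
      (∑ i, n i) * ∑ i, n i := by
    rw [← Finset.sum_add_distrib, Finset.sum_mul]
    refine Finset.sum_congr rfl fun i _ => ?_
    rw [← mul_add, Finset.sum_erase_add _ _ (Finset.mem_univ i)]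
  rw [key, hright, hN, hsq] at hleft
  zify at hleft
  linear_combination -hleft
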